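/- **Theorem 1.4.** Setting. Let $\mathbb T=\mathbb R/2\pi\mathbb Z$ with normalized measure $dx/2\pi$, $\widehat f(n)=\frac1{2\pi}\int_{\mathbb T} f(x)e^{-inx}\,dx$, $\langle x\rangle=(1+x^2)^{1/2}$ and $\|f\|_{H^s}^2=\sum_{n\in\mathbb Z}\langle n\rangle^{2s}|\widehat f(n)|^2$. Let $\mathcal H$ be the Hilbert transform, with Fourier multiplier $-\mathbf 1_{n\neq0}\,i\,\mathrm{sgn}(n)$. For $T>0$, a function $w\in C([0,T];\mathbb R)$ is $(\rho,\gamma)$-irregular on $[0,T]$ if $$\sup_{a\in\mathbb R}\ \sup_{0\le r<t\le T}\ \langle a\rangle^\rho\,\frac{\bigl|\int_r^t e^{iaw(t')}\,dt'\bigr|}{|t-r|^\gamma}<\infty ,$$ and it is $(\rho,\gamma)$-irregular on $\mathbb R_+$ if it is so on $[0,T']$ for every finite $T'>0$. Modulations are normalized by $w(0)=0$. The modulated Benjamin–Ono equation $$\partial_t u-\mathcal H\partial_x^2u\cdot\partial_t w=\partial_x u^2\quad\text{on }\mathbb T,\qquad u|_{t=0}=u_0 \tag{1}$$ is understood through its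 Duhamel formulation $$u(t)=U^w(t)u_0+U^w(t)\int_0^tU^w(t')^{-1}\partial_x u^2(t')\,dt',\qquad U^w(t)=e^{w(t)\mathcal H\partial_x^2},$$ as an identity between periodic distributions, i.e. for every Fourier coefficient. All initial data are assumed to have mean zero, $\widehat{u_0}(0)=0$. Statement. Let $\rho>\frac52$, $\frac12<\gamma<1$ and $T>0$, and let $w$ be $(\rho,\gamma)$-irregular on $[0,T]$. (i) (Unconditional well-posedness.) Let $s\ge0$. Then (1) is unconditionally locally well-posed in $H^s(\mathbb T)$: for every mean-zero $u_0\in H^s(\mathbb T)$ there exist $\tau\in(0,T]$ and a unique solution $u$ of (1) in the whole class $C([0,\tau];H^s(\mathbb T))$; if $u_0$ is real-valued, so is $u(t)$ for every $t\in[0,\tau]$. If, in addition, $w$ is $(\rho,\gamma)$-irregular on $\mathbb R_+$, then (1) is unconditionally globally well-posed in $H^s(\mathbb T)$: for every real-valued mean-zero $u_0\in H^s(\mathbb T)$ there is a unique solution $u$ of (1) in the whole class $C([0,\infty);H^s(\mathbb T))$, and it is real-valued. (ii) (Nonlinear smoothing.) Let $s_0>s\ge0$ satisfy $s_0\le\rho-1$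 and $s_0<s+\rho-\frac52$. Let $u_0\in H^s(\mathbb T)$ have mean zero, let $\tau\in(0,T]$ and let $u\in C([0,\tau];H^s(\mathbb T))$ be a solution of (1) (for instance the one from part (i)). Then $$u-e^{w(t)\mathcal H\partial_x^2}u_0\in C([0,\tau];H^{s_0}(\mathbb T)).$$ -/

import Mathlib

open MeasureTheory Filter Topology Set
open scoped ENNReal

noncomputable section

namespace ModulatedBO

instance twoPiPos : Fact (0 < 2 * Real.pi) := ⟨Real.two_pi_pos⟩

/-- The circle `ℝ / 2πℤ`. -/
abbrev Circle2Pi : Type := AddCircle (2 * Real.pi)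

/-- Complex-valued `L²` functions on the circle, with respect to the normalized measure
`dx / 2π`. With this normalization
`fourierCoeff f n = (2π)⁻¹ ∫ f(x) e^{-inx} dx`. -/
abbrev L2Circle : Type :=
  Lp ℂ 2 (AddCircle.haarAddCircle : Measure Circle2Pi)

/-- The bracket `⟨x⟩ = (1 + x²)^{1/2}`. -/
def bracket (x : ℝ) : ℝ := Real.sqrt (1 + x ^ 2)

/-! ### Sobolev spaces of nonnegative order

For `s ≥ 0` the space `H^s` of the circle consists of those `L²` functions whose Sobolev norm is
finite. Only orders `s ≥ 0` are used. -/

/-- Membership of an `L²` function in `H^s`. -/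
def MemSobolev (s : ℝ) (f : L2Circle) : Prop :=
  Summable fun n : ℤ => bracket n ^ (2 * s) * ‖fourierCoeff f n‖ ^ 2

/-- The norm of `H^s`: `‖f‖² = ∑ₙ ⟨n⟩^{2s} |f̂(n)|²`. -/
def sobolevNorm (s : ℝ) (f : L2Circle) : ℝ :=
  Real.sqrt (∑' n : ℤ, bracket n ^ (2 * s) * ‖fourierCoeff f n‖ ^ 2)

/-- `u ∈ C(J; H^s)` for a set `J` of times. -/
def ContinuousInSobolev (s : ℝ) (J : Set ℝ) (u : ℝ → L2Circle) : Prop :=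
  (∀ t ∈ J, MemSobolev s (u t)) ∧
    ∀ t ∈ J, Tendsto (fun r => sobolevNorm s (u r - u t)) (𝓝[J] t) (𝓝 0)

/-- The spatial mean `(2π)⁻¹ ∫ f dx` vanishes. -/
def MeanZero (f : L2Circle) : Prop := fourierCoeff f 0 = 0

/-- `f` is real-valued (almost everywhere). -/
def RealValued (f : L2Circle) : Prop :=
  ∀ᵐ x ∂(AddCircle.haarAddCircle : Measure Circle2Pi), (f x).im = 0

/-! ### Irregular modulations -/

/-- `Φ^w_{t,r}(a) = ∫_r^t e^{i a w(t')} dt'`. -/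
def oscillatoryIntegral (w : ℝ → ℝ) (t r a : ℝ) : ℂ :=
  ∫ t' in r..t, Complex.exp (Complex.I * a * w t')

/-- `w` is continuous on `[0,T]` and `(ρ,γ)`-irregular on `[0,T]`: the supremum over `a ∈ ℝ` and
`0 ≤ r < t ≤ T` of `⟨a⟩^ρ |Φ^w_{t,r}(a)| / |t - r|^γ` is finite. -/
def IsIrregularOn (ρ γ T : ℝ) (w : ℝ → ℝ) : Prop :=
  ContinuousOn w (Icc 0 T) ∧
    ∃ C : ℝ, ∀ a r t : ℝ, 0 ≤ r → r < t → t ≤ T →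
      bracket a ^ ρ * (‖oscillatoryIntegral w t r a‖ / |t - r| ^ γ) ≤ C

/-- `w` is `(ρ,γ)`-irregular on `ℝ₊`: it is so on `[0,T]` for each finite `T > 0`. -/
def IsIrregularOnHalfLine (ρ γ : ℝ) (w : ℝ → ℝ) : Prop :=
  ∀ T : ℝ, 0 < T → IsIrregularOn ρ γ T w

/-! ### Fourier multipliers and the linear propagator -/

/-- The Fourier symbol of `∂ₓ`. -/
def derivSymbol (n : ℤ) : ℂ := Complex.I * n

/-- The Fourier symbol `-1_{n ≠ 0} i sgn(n)` of the Hilbert transform. -/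
def hilbertSymbol (n : ℤ) : ℂ := -(Complex.I * (n.sign : ℂ))

/-- The Fourier symbol of `H ∂ₓ²`. -/
def boSymbol (n : ℤ) : ℂ := hilbertSymbol n * derivSymbol n ^ 2

/-- The Fourier symbol of `e^{θ H ∂ₓ²}`. -/
def flowSymbol (θ : ℝ) (n : ℤ) : ℂ := Complex.exp (θ * boSymbol n)

theorem boSymbol_eq (n : ℤ) : boSymbol n = ((|n| * n : ℤ) : ℂ) * Complex.I := by
  have h : ((n.sign : ℤ) : ℂ) * n = (|n| : ℤ) := by
    rw [← Int.sign_mul_self_eq_abs]; push_cast; ring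
  have hI : Complex.I ^ 3 = -Complex.I := by
    rw [pow_succ, Complex.I_sq]; ring
  unfold boSymbol hilbertSymbol derivSymbol
  rw [Int.cast_mul, ← h]
  linear_combination (-(n.sign : ℂ) * n ^ 2) * hI

theorem norm_flowSymbol (θ : ℝ) (n : ℤ) : ‖flowSymbol θ n‖ = 1 := by
  have : (θ : ℂ) * boSymbol n = ((θ * ((|n| * n : ℤ) : ℝ) : ℝ) : ℂ) * Complex.I := by
    rw [boSymbol_eq]; simp only [Complex.ofReal_mul, Complex.ofReal_intCast]; ring
  rw [flowSymbol, this, Complex.norm_exp_ofReal_mul_I]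

theorem memlp_flow (θ : ℝ) (f : L2Circle) :
    Memℓp (fun n : ℤ => flowSymbol θ n * fourierBasis.repr f n) 2 := by
  have h := lp.memℓp (fourierBasis.repr f)
  rw [memℓp_gen_iff (by norm_num)] at h ⊢
  simpa [norm_flowSymbol] using h

/-- The operator `e^{θ H ∂ₓ²}` on `L²`, i.e. the Fourier multiplier with symbol `flowSymbol θ`. -/
def linearFlow (θ : ℝ) (f : L2Circle) : L2Circle :=
  fourierBasis.repr.symm ⟨fun n => flowSymbol θ n * fourierBasis.repr f n, memlp_flow θ f⟩

theorem fourierCoeff_linearFlow (θ : ℝ) (f : L2Circle) (n : ℤ) :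
    fourierCoeff (linearFlow θ f) n = flowSymbol θ n * fourierCoeff f n := by
  rw [← fourierBasis_repr, ← fourierBasis_repr, linearFlow]
  simp

/-! ### The modulated Benjamin–Ono equation -/

/-- `u` is a solution in `C(J; H^s)` of `∂ₜu - H∂ₓ²u · ∂ₜw = ∂ₓ(u²)` with initial datum `u₀`, for an
interval `J` of times starting at `0`. With `U(t) = e^{w(t) H∂ₓ²}` the equation means
`u(t) = U(t) u₀ + U(t) ∫₀ᵗ U(t')⁻¹ ∂ₓ(u(t')²) dt'`, an identity between periodic
distributions, that is, between all their Fourier coefficients. For `u(t') ∈ L²` the square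
`u(t')²` is the pointwise one, an `L¹` function. -/
structure IsSolution (w : ℝ → ℝ) (s : ℝ) (J : Set ℝ) (u₀ : L2Circle) (u : ℝ → L2Circle) :
    Prop where
  continuous : ContinuousInSobolev s J u
  initial : u 0 = u₀
  duhamel : ∀ t ∈ J, ∀ n : ℤ,
    fourierCoeff (u t) n =
      flowSymbol (w t) n * fourierCoeff u₀ n +
        flowSymbol (w t) n *
          ∫ t' in (0 : ℝ)..t, (flowSymbol (w t') n)⁻¹ *
            (derivSymbol n * fourierCoeff (fun x : Circle2Pi => (u t' x) ^ 2) n)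

/-- `u` is the unique solution in the whole class `C(J; H^s)`. -/
def IsUniqueSolution (w : ℝ → ℝ) (s : ℝ) (J : Set ℝ) (u₀ : L2Circle) (u : ℝ → L2Circle) : Prop :=
  IsSolution w s J u₀ u ∧
    ∀ v : ℝ → L2Circle, IsSolution w s J u₀ v → ∀ t ∈ J, v t = u t

/-- Unconditional local well-posedness in `H^s` (mean-zero data): each `u₀` has a time
`τ ∈ (0,T]` and a unique solution in `C([0,τ]; H^s)`. Data may be complex-valued; the solution is
real-valued when the datum is. -/
def UnconditionallyLocallyWellPosed (w : ℝ → ℝ) (T s : ℝ) : Prop :=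
  ∀ u₀ : L2Circle, MemSobolev s u₀ → MeanZero u₀ →
    ∃ τ : ℝ, 0 < τ ∧ τ ≤ T ∧ ∃ u : ℝ → L2Circle,
      IsUniqueSolution w s (Icc 0 τ) u₀ u ∧
        (RealValued u₀ → ∀ t ∈ Icc 0 τ, RealValued (u t))

/-- Unconditional global well-posedness in `H^s` (real-valued mean-zero data): each `u₀` has a
real-valued solution in `C([0,∞); H^s)`, unique even among complex-valued ones. -/
def UnconditionallyGloballyWellPosed (w : ℝ → ℝ) (s : ℝ) : Prop :=
  ∀ u₀ : L2Circle, MemSobolev s u₀ → MeanZero u₀ → RealValued u₀ →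
    ∃ u : ℝ → L2Circle,
      IsUniqueSolution w s (Ici 0) u₀ u ∧ ∀ t ∈ Ici (0 : ℝ), RealValued (u t)

end ModulatedBO

end

namespace ModulatedBO

/-! ### The bracket -/

/-! Conjugation by the propagator removes the linear part. For `v(t) = U^w(t)⁻¹ u(t)` the
coefficients satisfy `∂ₜ v_n = i n ∑_m e^{i w(t) Ω(n,m)} v_m v_{n-m}` with `Ω(n,m) = |m|m +
|n-m|(n-m) - |n|n`. Mean-zero paths involve only nonzero `n`, `m`, `n - m`. There `|Ω|` is twice the
product of the two smaller of the three sizes, hence at least the largest of them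
(`resonance_bounds`).

Irregularity says that the time primitive of `e^{i w Ω}` over `[r,t]` is `O(|t-r|^γ ⟨Ω⟩^{-ρ})`.
Integrating by parts in time trades the oscillating factor for this primitive; `w` itself is never
differentiated. The cost is a factor `∂ₜ v`, which for `v ∈ L²` is only `O(|n|)` at frequency `n`.
Together with the outer derivative this produces the kernel `⟨n⟩^σ |n| |n-m| ⟨Ω⟩^{-ρ}`, which is
Hilbert–Schmidt for `0 ≤ σ < ρ - 5/2` (`summable_resonanceKernel_sq`). So the Duhamel integral gains
`σ` derivatives and is `γ`-Hölder in time (`normal_form_bound`, `OscillationBound.normal_form`).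

With `σ = 0` and short time the Duhamel map is a contraction for the norm that measures `v` in `H^s`
and `∂ₜ v` one derivative lower in a sup norm. Every solution in `C([0,τ]; L²)` has that norm finite
on short intervals, so uniqueness needs no auxiliary space (`interaction_unique`). The estimates are
tame: each `H^s` factor is paired with an `L²` factor, so for fixed `s` the local time depends only
on the `L²` size of the datum (`exists_interaction_solution`).

Real data stay real, by uniqueness and the conjugation symmetry. For smooth real solutions the `L²`
norm is conserved because `∫ u ∂ₓ(u²) = 0`; stability carries this to rough data as a non-increasing
bound (`sobolevBound_zero_preserved`), and the local solutions can then be continued with a fixed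
time step. Smoothing is the case `σ = s₀ - s`, applied to `v(t) - v(0)`
(`duhamel_sobolevContinuousOn`). -/

theorem one_le_bracket (x : ℝ) : 1 ≤ bracket x := by
  rw [bracket, Real.one_le_sqrt]; nlinarith [sq_nonneg x]

theorem bracket_pos (x : ℝ) : 0 < bracket x := lt_of_lt_of_le one_pos (one_le_bracket x)

theorem abs_le_bracket (x : ℝ) : |x| ≤ bracket x := by
  rw [bracket]; exact Real.abs_le_sqrt (by linarith)

theorem bracket_le_one_add_abs (x : ℝ) : bracket x ≤ 1 + |x| := by
  rw [bracket, Real.sqrt_le_left (by positivity)]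
  nlinarith [abs_nonneg x, sq_abs x]

@[simp] theorem bracket_neg (x : ℝ) : bracket (-x) = bracket x := by simp [bracket]

theorem bracket_rpow_pos (x s : ℝ) : 0 < bracket x ^ s := Real.rpow_pos_of_pos (bracket_pos x) s

theorem bracket_add_le (x y : ℝ) : bracket (x + y) ≤ bracket x + bracket y := by
  have hx := bracket_pos x
  have hy := bracket_pos y
  have hx2 : bracket x ^ 2 = 1 + x ^ 2 := Real.sq_sqrt (by positivity)
  have hy2 : bracket y ^ 2 = 1 + y ^ 2 := Real.sq_sqrt (by positivity)
  have h := mul_le_mul (abs_le_bracket x) (abs_le_bracket y) (abs_nonneg y) hx.le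
  rw [bracket, Real.sqrt_le_left (by positivity)]
  nlinarith [le_abs_self (x * y), abs_mul x y]

theorem bracket_add_rpow_le (x y : ℝ) {s : ℝ} (hs : 0 ≤ s) :
    bracket (x + y) ^ s ≤ 2 ^ s * (bracket x ^ s + bracket y ^ s) := by
  wlog h : bracket y ≤ bracket x generalizing x y
  · rw [add_comm x y, add_comm (bracket x ^ s)]; exact this y x (le_of_not_ge h)
  calc bracket (x + y) ^ s ≤ (2 * bracket x) ^ s :=
        Real.rpow_le_rpow (bracket_pos _).le (by linarith [bracket_add_le x y]) hs
    _ = 2 ^ s * bracket x ^ s := Real.mul_rpow (by norm_num) (bracket_pos x).le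
    _ ≤ _ := by
        gcongr
        linarith [bracket_rpow_pos y s]

/-! ### Bounds for sequences of Fourier coefficients -/

/-- The sequence `a` has `H^s` norm at most `M`. -/
def SobolevBound (s M : ℝ) (a : ℤ → ℂ) : Prop :=
  0 ≤ M ∧ ∀ S : Finset ℤ, ∑ n ∈ S, (bracket n ^ s * ‖a n‖) ^ 2 ≤ M ^ 2

/-- The sequence `F` is, up to one derivative, bounded by `⟨n⟩^{-s} B`. -/
def DerivBound (s B : ℝ) (F : ℤ → ℂ) : Prop :=
  0 ≤ B ∧ ∀ n : ℤ, bracket n ^ s * ‖F n‖ ≤ |(n : ℝ)| * B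

theorem sum_mul_le_of_sq {ι : Type*} (S : Finset ι) (x y : ι → ℝ) {A B : ℝ} (hA : 0 ≤ A)
    (hB : 0 ≤ B) (hx : ∑ i ∈ S, x i ^ 2 ≤ A ^ 2) (hy : ∑ i ∈ S, y i ^ 2 ≤ B ^ 2) :
    ∑ i ∈ S, x i * y i ≤ A * B := by
  have h := Finset.sum_mul_sq_le_sq_mul_sq S x y
  have h1 : (∑ i ∈ S, x i * y i) ^ 2 ≤ (A * B) ^ 2 := by
    rw [mul_pow]
    exact h.trans (mul_le_mul hx hy (Finset.sum_nonneg fun i _ => sq_nonneg _) (sq_nonneg _))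
  exact (le_abs_self _).trans (abs_le_of_sq_le_sq h1 (by positivity))

theorem sum_add_sq_le {ι : Type*} (S : Finset ι) (x y : ι → ℝ) {A B : ℝ} (hA : 0 ≤ A) (hB : 0 ≤ B)
    (hx : ∑ i ∈ S, x i ^ 2 ≤ A ^ 2) (hy : ∑ i ∈ S, y i ^ 2 ≤ B ^ 2) :
    ∑ i ∈ S, (x i + y i) ^ 2 ≤ (A + B) ^ 2 := by
  have h2 := sum_mul_le_of_sq S x y hA hB hx hy
  have h3 : ∑ i ∈ S, (x i + y i) ^ 2
      = ∑ i ∈ S, x i ^ 2 + 2 * ∑ i ∈ S, x i * y i + ∑ i ∈ S, y i ^ 2 := by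
    rw [Finset.mul_sum, ← Finset.sum_add_distrib, ← Finset.sum_add_distrib]
    exact Finset.sum_congr rfl fun i _ => by ring
  rw [h3]; nlinarith

namespace SobolevBound

variable {s M M' : ℝ} {a b : ℤ → ℂ}

theorem of_norm_le (h : SobolevBound s M b) (hab : ∀ n, ‖a n‖ ≤ ‖b n‖) : SobolevBound s M a := by
  refine ⟨h.1, fun S => (Finset.sum_le_sum fun n _ => ?_).trans (h.2 S)⟩
  have := bracket_rpow_pos n s
  gcongr
  exact hab n

theorem mono (h : SobolevBound s M a) (hM : M ≤ M') : SobolevBound s M' a :=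
  ⟨h.1.trans hM, fun S => (h.2 S).trans (pow_le_pow_left₀ h.1 hM 2)⟩

theorem add (ha : SobolevBound s M a) (hb : SobolevBound s M' b) :
    SobolevBound s (M + M') (fun n => a n + b n) := by
  refine ⟨add_nonneg ha.1 hb.1, fun S => ?_⟩
  refine (Finset.sum_le_sum fun n _ => ?_).trans
    (sum_add_sq_le S _ _ ha.1 hb.1 (ha.2 S) (hb.2 S))
  have := bracket_rpow_pos n s
  rw [← mul_add]
  gcongr
  exact norm_add_le _ _

theorem neg (ha : SobolevBound s M a) : SobolevBound s M (fun n => -a n) :=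
  ha.of_norm_le fun n => by simp

theorem sub (ha : SobolevBound s M a) (hb : SobolevBound s M' b) :
    SobolevBound s (M + M') (fun n => a n - b n) := by
  simpa [sub_eq_add_neg] using ha.add hb.neg

theorem zero (s : ℝ) : SobolevBound s 0 (fun _ => 0) := ⟨le_rfl, fun S => by simp⟩

theorem le (ha : SobolevBound s M a) (n : ℤ) : bracket n ^ s * ‖a n‖ ≤ M := by
  have h := ha.2 {n}
  rw [Finset.sum_singleton] at h
  exact (le_abs_self _).trans (abs_le_of_sq_le_sq h ha.1)

theorem of_le_order {s' : ℝ} (ha : SobolevBound s M a) (hs : s' ≤ s) : SobolevBound s' M a := by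
  refine ⟨ha.1, fun S => (Finset.sum_le_sum fun n _ => ?_).trans (ha.2 S)⟩
  have := bracket_rpow_pos n s'
  gcongr
  exact one_le_bracket n

theorem norm_le (ha : SobolevBound 0 M a) (n : ℤ) : ‖a n‖ ≤ M := by simpa using ha.le n

theorem summable (ha : SobolevBound s M a) : Summable fun n : ℤ => (bracket n ^ s * ‖a n‖) ^ 2 :=
  summable_of_sum_le (fun _ => sq_nonneg _) ha.2

/-- Fatou: the bound concerns finite sums only, so it survives coefficientwise limits without any
strong convergence. -/
theorem of_tendsto {ι : Type*} {l : Filter ι} [l.NeBot] {c : ι → ℤ → ℂ}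
    (h : ∀ᶠ i in l, SobolevBound s M (c i)) (hc : ∀ n, Tendsto (fun i => c i n) l (𝓝 (a n))) :
    SobolevBound s M a := by
  obtain ⟨i, hi⟩ := h.exists
  refine ⟨hi.1, fun S => ?_⟩
  have ht : Tendsto (fun i => ∑ n ∈ S, (bracket n ^ s * ‖c i n‖) ^ 2) l
      (𝓝 (∑ n ∈ S, (bracket n ^ s * ‖a n‖) ^ 2)) :=
    tendsto_finsetSum _ fun n _ => ((hc n).norm.const_mul _).pow 2
  exact le_of_tendsto ht (h.mono fun i hi => hi.2 S)

theorem of_tendsto_bound {ι : Type*} {l : Filter ι} [l.NeBot] {m : ι → ℝ}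
    (h : ∀ᶠ i in l, SobolevBound s (m i) a) (hm : Tendsto m l (𝓝 M)) : SobolevBound s M a :=
  ⟨ge_of_tendsto hm (h.mono fun _ hi => hi.1), fun S =>
    ge_of_tendsto (hm.pow 2) (h.mono fun _ hi => hi.2 S)⟩

/-- Nonzero integers satisfy `|n| ≥ 1`, so a mean-zero sequence may also play the role of a
differentiated factor; this covers the boundary term of the integration by parts. -/
theorem derivBound (ha : SobolevBound s M a) (h0 : a 0 = 0) : DerivBound s M a := by
  refine ⟨ha.1, fun n => ?_⟩
  rcases eq_or_ne n 0 with rfl | hn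
  · simp [h0]
  · have h1 : (1 : ℝ) ≤ |(n : ℝ)| := by exact_mod_cast Int.one_le_abs hn
    nlinarith [ha.le n, ha.1]

theorem summable_sq (ha : SobolevBound s M a) (hs : 0 ≤ s) : Summable fun n : ℤ => ‖a n‖ ^ 2 := by
  simpa using (ha.of_le_order hs).summable

/-- A sequence with square-summable weighted coefficients has small tails. -/
theorem exists_finset_tail (ha : SobolevBound s M a) {ε : ℝ} (hε : 0 < ε) :
    ∃ S : Finset ℤ, SobolevBound s ε (fun n => if n ∈ S then 0 else a n) := by
  obtain ⟨S, hS⟩ := (summable_iff_vanishing_norm.1 ha.summable) (ε ^ 2) (by positivity)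
  refine ⟨S, hε.le, fun S' => ?_⟩
  have h := hS (S' \ S) Finset.sdiff_disjoint
  rw [Real.norm_eq_abs] at h
  refine le_trans (le_of_eq ?_) ((le_abs_self _).trans h.le)
  rw [← Finset.sum_sdiff (Finset.inter_subset_left (s₁ := S') (s₂ := S))]
  rw [Finset.sdiff_inter_self_left]
  have : ∑ x ∈ S' ∩ S, (bracket x ^ s * ‖(if x ∈ S then 0 else a x)‖) ^ 2 = 0 :=
    Finset.sum_eq_zero fun x hx => by simp [(Finset.mem_inter.1 hx).2]
  rw [this, add_zero]
  exact Finset.sum_congr rfl fun x hx => by simp [(Finset.mem_sdiff.1 hx).2]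

end SobolevBound

namespace DerivBound

variable {s B B' : ℝ} {F G : ℤ → ℂ}

theorem mono (h : DerivBound s B F) (hB : B ≤ B') : DerivBound s B' F :=
  ⟨h.1.trans hB, fun n => (h.2 n).trans (by gcongr)⟩

theorem add (hF : DerivBound s B F) (hG : DerivBound s B' G) :
    DerivBound s (B + B') (fun n => F n + G n) := by
  refine ⟨add_nonneg hF.1 hG.1, fun n => ?_⟩
  have := bracket_rpow_pos n s
  calc bracket n ^ s * ‖F n + G n‖ ≤ bracket n ^ s * (‖F n‖ + ‖G n‖) := by
        gcongr; exact norm_add_le _ _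
    _ ≤ _ := by rw [mul_add, mul_add]; exact add_le_add (hF.2 n) (hG.2 n)

theorem neg (hF : DerivBound s B F) : DerivBound s B (fun n => -F n) :=
  ⟨hF.1, fun n => by simpa using hF.2 n⟩

theorem sub (hF : DerivBound s B F) (hG : DerivBound s B' G) :
    DerivBound s (B + B') (fun n => F n - G n) := by
  simpa [sub_eq_add_neg] using hF.add hG.neg

theorem map_zero (hF : DerivBound s B F) : F 0 = 0 := by
  have h := hF.2 0
  have := bracket_rpow_pos ((0 : ℤ) : ℝ) s
  simp only [Int.cast_zero, abs_zero, zero_mul] at h this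
  have h2 : ‖F 0‖ ≤ 0 := by
    by_contra hc
    push Not at hc
    nlinarith [mul_pos this hc]
  simpa using h2

theorem zero (s : ℝ) : DerivBound s 0 (fun _ => 0) := ⟨le_rfl, fun n => by simp⟩

theorem norm_le (hF : DerivBound 0 B F) (n : ℤ) : ‖F n‖ ≤ |(n : ℝ)| * B := by simpa using hF.2 n

end DerivBound

/-! ### Convolution sums -/

section Convolution

variable {A B : ℝ} {a b : ℤ → ℂ}

theorem sum_norm_mul_le (ha : SobolevBound 0 A a) (hb : SobolevBound 0 B b) (n : ℤ)
    (S : Finset ℤ) : ∑ m ∈ S, ‖a m‖ * ‖b (n - m)‖ ≤ A * B := by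
  refine sum_mul_le_of_sq S _ _ ha.1 hb.1 (by simpa using ha.2 S) ?_
  have h := hb.2 (S.image fun m => n - m)
  rw [Finset.sum_image (fun x _ y _ h => by simpa using h)] at h
  simpa using h

theorem summable_norm_mul (ha : SobolevBound 0 A a) (hb : SobolevBound 0 B b) (n : ℤ) :
    Summable fun m => ‖a m‖ * ‖b (n - m)‖ :=
  summable_of_sum_le (fun _ => by positivity) (sum_norm_mul_le ha hb n)

end Convolution

/-! ### The resonance function -/

/-- The resonance function `Ω(n,m) = |m|m + |n-m|(n-m) - |n|n`. -/
def resonance (n m : ℤ) : ℤ := |m| * m + |n - m| * (n - m) - |n| * n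

theorem resonance_symm (n m : ℤ) : resonance n (n - m) = resonance n m := by
  unfold resonance; rw [sub_sub_cancel]; ring

/-- Among `n`, `m`, `n - m` the largest size is the sum of the other two, and in each sign pattern
`|Ω|` factors as twice the product of these two. Since both are at least 1, twice their product
dominates their sum, hence every one of the three. -/
theorem resonance_bounds {n m : ℤ} (hn : n ≠ 0) (hm : m ≠ 0) (hnm : n - m ≠ 0) :
    |n| ≤ |resonance n m| ∧ |n - m| ≤ |resonance n m| ∧
      (|n| * |m| ≤ |resonance n m| ∨ |n| * |n - m| ≤ |resonance n m|) := by
  unfold resonance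
  obtain ⟨k, rfl⟩ : ∃ k, n = m + k := ⟨n - m, by ring⟩
  have hk : m + k - m = k := by ring
  rw [hk] at hnm ⊢
  rcases lt_or_gt_of_ne hm with hm' | hm' <;> rcases lt_or_gt_of_ne hnm with hk' | hk' <;>
    rcases lt_or_gt_of_ne hn with hn' | hn'
  · rw [abs_of_neg hm', abs_of_neg hk', abs_of_neg hn',
      show -m * m + -k * k - -(m + k) * (m + k) = 2 * (m * k) by ring,
      abs_of_pos (by nlinarith)]
    refine ⟨by nlinarith, by nlinarith, ?_⟩
    rcases le_total m k with h | h
    · right; nlinarith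
    · left; nlinarith
  · omega
  · rw [abs_of_neg hm', abs_of_pos hk', abs_of_neg hn',
      show -m * m + k * k - -(m + k) * (m + k) = 2 * (k * (m + k)) by ring,
      abs_of_neg (by nlinarith)]
    refine ⟨by nlinarith, by nlinarith, ?_⟩
    right; nlinarith
  · rw [abs_of_neg hm', abs_of_pos hk', abs_of_pos hn',
      show -m * m + k * k - (m + k) * (m + k) = 2 * ((-m) * (m + k)) by ring,
      abs_of_pos (by nlinarith)]
    refine ⟨by nlinarith, by nlinarith, ?_⟩
    left; nlinarith
  · rw [abs_of_pos hm', abs_of_neg hk', abs_of_neg hn',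
      show m * m + -k * k - -(m + k) * (m + k) = 2 * (m * (m + k)) by ring,
      abs_of_neg (by nlinarith)]
    refine ⟨by nlinarith, by nlinarith, ?_⟩
    left; nlinarith
  · rw [abs_of_pos hm', abs_of_neg hk', abs_of_pos hn',
      show m * m + -k * k - (m + k) * (m + k) = 2 * (-k * (m + k)) by ring,
      abs_of_pos (by nlinarith)]
    refine ⟨by nlinarith, by nlinarith, ?_⟩
    right; nlinarith
  · omega
  · rw [abs_of_pos hm', abs_of_pos hk', abs_of_pos hn',
      show m * m + k * k - (m + k) * (m + k) = -2 * (m * k) by ring,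
      abs_of_neg (by nlinarith)]
    refine ⟨by nlinarith, by nlinarith, ?_⟩
    rcases le_total m k with h | h
    · left; nlinarith
    · right; nlinarith

/-! ### The Hilbert–Schmidt kernel -/

/-- The kernel `⟨n⟩^σ |n| |n-m| ⟨Ω(n,m)⟩^{-ρ}` on the nondegenerate frequencies. -/
noncomputable def resonanceKernel (σ ρ : ℝ) (n m : ℤ) : ℝ :=
  if n ≠ 0 ∧ m ≠ 0 ∧ n - m ≠ 0 then
    bracket n ^ σ * (|(n : ℝ)| * |((n - m : ℤ) : ℝ)|) * bracket (resonance n m) ^ (-ρ)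
  else 0

theorem resonanceKernel_nonneg (σ ρ : ℝ) (n m : ℤ) : 0 ≤ resonanceKernel σ ρ n m := by
  unfold resonanceKernel
  have := bracket_rpow_pos n σ
  have := bracket_rpow_pos (resonance n m) (-ρ)
  split_ifs <;> positivity

/-- The factors `⟨n⟩^σ`, `|n|` and `|n-m|` are each absorbed by a power of `|Ω|`, leaving
`|Ω|^{-(ρ-2-σ)}`. The lower bound of `|Ω|` by `|n||m|` or `|n||n-m|` then separates the variables.
-/
theorem resonanceKernel_sq_le {σ ρ : ℝ} (hσ : 0 ≤ σ) (h : σ < ρ - 5 / 2) (n m : ℤ) :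
    resonanceKernel σ ρ n m ^ 2 ≤ (2 ^ σ) ^ 2 *
      (|(n : ℝ)| ^ (-(2 * (ρ - 2 - σ))) * |(m : ℝ)| ^ (-(2 * (ρ - 2 - σ))) +
        |(n : ℝ)| ^ (-(2 * (ρ - 2 - σ))) * |((n - m : ℤ) : ℝ)| ^ (-(2 * (ρ - 2 - σ)))) := by
  unfold resonanceKernel
  split_ifs with hd
  swap
  · rw [zero_pow two_ne_zero]; positivity
  obtain ⟨hn, hm, hnm⟩ := hd
  obtain ⟨h1, h2, h3⟩ := resonance_bounds hn hm hnm
  set e := ρ - 2 - σ with he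
  have he0 : 1 / 2 < e := by linarith
  have hn1 : (1 : ℝ) ≤ |(n : ℝ)| := by exact_mod_cast Int.one_le_abs hn
  have hm1 : (1 : ℝ) ≤ |(m : ℝ)| := by exact_mod_cast Int.one_le_abs hm
  have hk1 : (1 : ℝ) ≤ |((n - m : ℤ) : ℝ)| := by exact_mod_cast Int.one_le_abs hnm
  set W : ℝ := |(resonance n m : ℝ)| with hW
  have h1' : |(n : ℝ)| ≤ W := by rw [hW]; exact_mod_cast h1
  have h2' : |((n - m : ℤ) : ℝ)| ≤ W := by rw [hW]; exact_mod_cast h2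
  have hW1 : 1 ≤ W := hn1.trans h1'
  have hW0 : 0 < W := by linarith
  -- The factor 2 comes from `⟨n⟩ ≤ 1 + |n| ≤ 2W`, as `W ≥ |n| ≥ 1`.
  have hb : bracket n ^ σ ≤ 2 ^ σ * W ^ σ := by
    rw [← Real.mul_rpow (by norm_num) hW0.le]
    refine Real.rpow_le_rpow (bracket_pos _).le ?_ hσ
    linarith [bracket_le_one_add_abs (n : ℝ)]
  have hr : bracket (resonance n m) ^ (-ρ) ≤ W ^ (-ρ) :=
    Real.rpow_le_rpow_of_nonpos hW0 (abs_le_bracket _) (by linarith)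
  have hmain : bracket n ^ σ * (|(n : ℝ)| * |((n - m : ℤ) : ℝ)|) *
      bracket (resonance n m) ^ (-ρ) ≤ 2 ^ σ * W ^ (-e) := by
    calc _ ≤ (2 ^ σ * W ^ σ) * (W * W) * W ^ (-ρ) := by
          have := bracket_rpow_pos n σ
          have := bracket_rpow_pos (resonance n m) (-ρ)
          gcongr
      _ = 2 ^ σ * (W ^ σ * W ^ (2 : ℝ) * W ^ (-ρ)) := by
          rw [Real.rpow_two]; ring
      _ = _ := by
          rw [← Real.rpow_add hW0, ← Real.rpow_add hW0]; congr 2; rw [he]; ring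
  have hpos : 0 ≤ bracket n ^ σ * (|(n : ℝ)| * |((n - m : ℤ) : ℝ)|) *
      bracket (resonance n m) ^ (-ρ) := by
    have := bracket_rpow_pos n σ
    have := bracket_rpow_pos (resonance n m) (-ρ)
    positivity
  refine (pow_le_pow_left₀ hpos hmain 2).trans ?_
  rw [mul_pow]
  gcongr
  have hWe : (W ^ (-e)) ^ 2 = W ^ (-(2 * e)) := by
    rw [← Real.rpow_natCast, ← Real.rpow_mul hW0.le]; congr 1; push_cast; ring
  rw [hWe, ← Real.mul_rpow (by positivity) (by positivity),
    ← Real.mul_rpow (by positivity) (by positivity)]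
  rcases h3 with h3 | h3
  · have h3' : |(n : ℝ)| * |(m : ℝ)| ≤ W := by rw [hW]; exact_mod_cast h3
    have := Real.rpow_le_rpow_of_nonpos (by positivity) h3' (show -(2 * e) ≤ 0 by linarith)
    refine this.trans (le_add_of_nonneg_right (by positivity))
  · have h3' : |(n : ℝ)| * |((n - m : ℤ) : ℝ)| ≤ W := by rw [hW]; exact_mod_cast h3
    have := Real.rpow_le_rpow_of_nonpos (by positivity) h3' (show -(2 * e) ≤ 0 by linarith)
    refine this.trans (le_add_of_nonneg_left (by positivity))

/-- The shear `(n, m) ↦ (n, n - m)` of `ℤ × ℤ`. -/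
def shearEquiv : ℤ × ℤ ≃ ℤ × ℤ where
  toFun p := (p.1, p.1 - p.2)
  invFun p := (p.1, p.1 - p.2)
  left_inv p := by simp
  right_inv p := by simp

/-- The condition `σ < ρ - 5/2` says exactly that the exponent `2(ρ-2-σ)` exceeds 1. The second
product in the bound is the first one composed with the shear. -/
theorem summable_resonanceKernel_sq {σ ρ : ℝ} (hσ : 0 ≤ σ) (h : σ < ρ - 5 / 2) :
    Summable fun p : ℤ × ℤ => resonanceKernel σ ρ p.1 p.2 ^ 2 := by
  have h1 : Summable fun n : ℤ => |(n : ℝ)| ^ (-(2 * (ρ - 2 - σ))) :=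
    Real.summable_abs_int_rpow (by linarith)
  have h2 := h1.mul_of_nonneg h1 (fun n => by positivity) (fun n => by positivity)
  have h3 := (shearEquiv.summable_iff).2 h2
  refine Summable.of_nonneg_of_le (fun p => sq_nonneg _)
    (fun p => resonanceKernel_sq_le hσ h p.1 p.2) ((h2.add h3).mul_left _)

theorem exists_resonanceKernel_bound {σ ρ : ℝ} (hσ : 0 ≤ σ) (h : σ < ρ - 5 / 2) :
    ∃ H : ℝ, 0 ≤ H ∧ ∀ (S : Finset ℤ) (S' : ℤ → Finset ℤ),
      ∑ n ∈ S, ∑ m ∈ S' n, resonanceKernel σ ρ n m ^ 2 ≤ H ^ 2 := by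
  refine ⟨Real.sqrt (∑' p : ℤ × ℤ, resonanceKernel σ ρ p.1 p.2 ^ 2), Real.sqrt_nonneg _,
    fun S S' => ?_⟩
  rw [Real.sq_sqrt (tsum_nonneg fun _ => sq_nonneg _)]
  rw [Finset.sum_sigma']
  have := (summable_resonanceKernel_sq hσ h).sum_le_tsum
    ((S.sigma S').map (Equiv.sigmaEquivProd ℤ ℤ).toEmbedding) (fun _ _ => sq_nonneg _)
  rw [Finset.sum_map] at this
  simpa using this

/-- The constant is at least the Hilbert–Schmidt norm of the resonance kernel. -/
def IsKernelBound (σ ρ H : ℝ) : Prop :=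
  0 ≤ H ∧ ∀ (S : Finset ℤ) (S' : ℤ → Finset ℤ),
    ∑ n ∈ S, ∑ m ∈ S' n, resonanceKernel σ ρ n m ^ 2 ≤ H ^ 2

/-- Cauchy–Schwarz in `m`: the operator norm on `ℓ²` is at most the Hilbert–Schmidt norm. -/
theorem IsKernelBound.sum_sq_le {σ ρ H : ℝ} (hH : IsKernelBound σ ρ H) {p : ℤ → ℝ} {P : ℝ}
    (hp : ∀ S : Finset ℤ, ∑ m ∈ S, p m ^ 2 ≤ P ^ 2) (S : Finset ℤ) (S' : ℤ → Finset ℤ) :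
    ∑ n ∈ S, (∑ m ∈ S' n, resonanceKernel σ ρ n m * p m) ^ 2 ≤ (H * P) ^ 2 := by
  calc _ ≤ ∑ n ∈ S, (∑ m ∈ S' n, resonanceKernel σ ρ n m ^ 2) * P ^ 2 := by
        refine Finset.sum_le_sum fun n _ => (Finset.sum_mul_sq_le_sq_mul_sq _ _ _).trans ?_
        gcongr
        exact hp _
    _ ≤ _ := by
        rw [← Finset.sum_mul, mul_pow]
        gcongr
        exact hH.2 S S'

/-- The basic bilinear estimate: one factor in `L²`, the other with a derivative on a bounded
sequence, and coefficients decaying like `⟨Ω⟩^{-ρ}`. -/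
theorem IsKernelBound.sobolevBound {σ ρ H s D P Q P₀ Q₀ : ℝ} (hH : IsKernelBound σ ρ H)
    (hs : 0 ≤ s) (hD : 0 ≤ D) {p q : ℤ → ℂ} {c : ℤ → ℤ → ℂ}
    (hc : ∀ n m, ‖c n m‖ ≤ D * bracket (resonance n m) ^ (-ρ))
    (hp0 : p 0 = 0) (hp : SobolevBound s P p) (hp' : SobolevBound 0 P₀ p)
    (hq : DerivBound s Q q) (hq' : DerivBound 0 Q₀ q) (S' : ℤ → Finset ℤ) :
    SobolevBound (s + σ) (D * H * 2 ^ s * (P * Q₀ + P₀ * Q))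
      (fun n => Complex.I * n * ∑ m ∈ S' n, c n m * (p m * q (n - m))) := by
  have hH0 := hH.1
  have hP := hp.1
  have hP₀ := hp'.1
  have hQ := hq.1
  have hQ₀ := hq'.1
  refine ⟨by positivity, fun S => ?_⟩
  have key : ∀ n : ℤ, bracket n ^ (s + σ) *
      ‖Complex.I * n * ∑ m ∈ S' n, c n m * (p m * q (n - m))‖ ≤
      D * 2 ^ s * (Q₀ * (∑ m ∈ S' n, resonanceKernel σ ρ n m * (bracket m ^ s * ‖p m‖)) +
        Q * ∑ m ∈ S' n, resonanceKernel σ ρ n m * ‖p m‖) := by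
    intro n
    have e1 : D * 2 ^ s * (Q₀ * (∑ m ∈ S' n, resonanceKernel σ ρ n m * (bracket m ^ s * ‖p m‖)) +
        Q * ∑ m ∈ S' n, resonanceKernel σ ρ n m * ‖p m‖) = ∑ m ∈ S' n,
        D * 2 ^ s * resonanceKernel σ ρ n m * ‖p m‖ * (Q₀ * bracket m ^ s + Q) := by
      rw [Finset.mul_sum, Finset.mul_sum, ← Finset.sum_add_distrib, Finset.mul_sum]
      exact Finset.sum_congr rfl fun m _ => by ring
    rw [e1, norm_mul, norm_mul, Complex.norm_I, one_mul, Complex.norm_intCast]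
    have hbpos := bracket_rpow_pos n (s + σ)
    calc _ ≤ bracket n ^ (s + σ) * (|(n : ℝ)| * ∑ m ∈ S' n, ‖c n m * (p m * q (n - m))‖) := by
          gcongr; exact norm_sum_le _ _
      _ = ∑ m ∈ S' n, bracket n ^ (s + σ) * (|(n : ℝ)| * ‖c n m * (p m * q (n - m))‖) := by
          rw [Finset.mul_sum, Finset.mul_sum]
      _ ≤ _ := Finset.sum_le_sum fun m _ => ?_
    have hknn := resonanceKernel_nonneg σ ρ n m
    have hms := bracket_rpow_pos m s
    by_cases hd : n ≠ 0 ∧ m ≠ 0 ∧ n - m ≠ 0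
    · have hk : resonanceKernel σ ρ n m = bracket n ^ σ * (|(n : ℝ)| * |((n - m : ℤ) : ℝ)|) *
        bracket (resonance n m) ^ (-ρ) := if_pos hd
      have hns := bracket_rpow_pos n s
      have hnσ := bracket_rpow_pos n σ
      have hrr := bracket_rpow_pos (resonance n m) (-ρ)
      -- The weight `⟨n⟩^s` falls on one factor at a time, so each resulting product has only one
      -- factor in order `s`.
      have hadd : bracket n ^ s ≤ 2 ^ s * (bracket m ^ s + bracket (n - m : ℤ) ^ s) := by
        have := bracket_add_rpow_le (m : ℝ) ((n - m : ℤ) : ℝ) hs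
        simpa using this
      have hqq : bracket n ^ s * ‖q (n - m)‖ ≤
          2 ^ s * (|((n - m : ℤ) : ℝ)| * (Q₀ * bracket m ^ s + Q)) := by
        calc bracket n ^ s * ‖q (n - m)‖
            ≤ 2 ^ s * (bracket m ^ s + bracket (n - m : ℤ) ^ s) * ‖q (n - m)‖ := by gcongr
          _ = 2 ^ s * (bracket m ^ s * ‖q (n - m)‖ + bracket (n - m : ℤ) ^ s * ‖q (n - m)‖) := by
              ring
          _ ≤ 2 ^ s * (bracket m ^ s * (|((n - m : ℤ) : ℝ)| * Q₀) +
              |((n - m : ℤ) : ℝ)| * Q) := by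
              refine mul_le_mul_of_nonneg_left (add_le_add ?_ (hq.2 _)) (by positivity)
              exact mul_le_mul_of_nonneg_left (hq'.norm_le _) hms.le
          _ = _ := by ring
      rw [hk, Real.rpow_add (bracket_pos _), norm_mul, norm_mul]
      calc _ = ‖c n m‖ * (bracket n ^ σ * |(n : ℝ)| * ‖p m‖) * (bracket n ^ s * ‖q (n - m)‖) := by
            ring
        _ ≤ (D * bracket (resonance n m) ^ (-ρ)) * (bracket n ^ σ * |(n : ℝ)| * ‖p m‖) *
            (2 ^ s * (|((n - m : ℤ) : ℝ)| * (Q₀ * bracket m ^ s + Q))) := by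
            gcongr
            exact hc n m
        _ = _ := by ring
    -- Degenerate frequencies do not contribute: `n = 0` is killed by the outer derivative, `m = 0`
    -- by the mean of `p`, and `n = m` by `q 0 = 0`.
    · have hz : |(n : ℝ)| * ‖c n m * (p m * q (n - m))‖ = 0 := by
        by_cases h1 : n = 0
        · simp [h1]
        by_cases h2 : m = 0
        · simp [h2, hp0]
        have h3 : n - m = 0 := by tauto
        simp [h3, hq.map_zero]
      rw [hz, mul_zero]
      positivity
  have b1 := hH.sum_sq_le (p := fun m => bracket m ^ s * ‖p m‖) hp.2 S S'
  have b2 := hH.sum_sq_le (p := fun m => ‖p m‖) (P := P₀) (by simpa using hp'.2) S S'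
  have b1' : ∑ n ∈ S, (Q₀ * ∑ m ∈ S' n, resonanceKernel σ ρ n m * (bracket m ^ s * ‖p m‖)) ^ 2
      ≤ (Q₀ * (H * P)) ^ 2 := by
    simp_rw [mul_pow Q₀]
    rw [← Finset.mul_sum]
    gcongr
  have b2' : ∑ n ∈ S, (Q * ∑ m ∈ S' n, resonanceKernel σ ρ n m * ‖p m‖) ^ 2
      ≤ (Q * (H * P₀)) ^ 2 := by
    simp_rw [mul_pow Q]
    rw [← Finset.mul_sum]
    gcongr
  have b3 := sum_add_sq_le S _ _ (by positivity) (by positivity) b1' b2'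
  calc _ ≤ ∑ n ∈ S, (D * 2 ^ s *
        (Q₀ * (∑ m ∈ S' n, resonanceKernel σ ρ n m * (bracket m ^ s * ‖p m‖)) +
        Q * ∑ m ∈ S' n, resonanceKernel σ ρ n m * ‖p m‖)) ^ 2 := by
        refine Finset.sum_le_sum fun n _ => pow_le_pow_left₀ ?_ (key n) 2
        have := bracket_rpow_pos n (s + σ)
        positivity
    _ ≤ (D * 2 ^ s) ^ 2 * (Q₀ * (H * P) + Q * (H * P₀)) ^ 2 := by
        simp_rw [mul_pow (D * 2 ^ s)]
        rw [← Finset.mul_sum]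
        gcongr
    _ = _ := by ring

/-- The version of `IsKernelBound.sobolevBound` with the roles of the factors exchanged. -/
theorem IsKernelBound.sobolevBound' {σ ρ H s D P Q P₀ Q₀ : ℝ} (hH : IsKernelBound σ ρ H)
    (hs : 0 ≤ s) (hD : 0 ≤ D) {p q : ℤ → ℂ} {c : ℤ → ℤ → ℂ}
    (hc : ∀ n m, ‖c n m‖ ≤ D * bracket (resonance n m) ^ (-ρ))
    (hp0 : p 0 = 0) (hp : SobolevBound s P p) (hp' : SobolevBound 0 P₀ p)
    (hq : DerivBound s Q q) (hq' : DerivBound 0 Q₀ q) (S' : ℤ → Finset ℤ) :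
    SobolevBound (s + σ) (D * H * 2 ^ s * (P * Q₀ + P₀ * Q))
      (fun n => Complex.I * n * ∑ m ∈ S' n, c n m * (q m * p (n - m))) := by
  -- Substitution `m ↦ n - m`, which leaves the resonance function unchanged.
  have h := hH.sobolevBound hs hD (c := fun n m => c n (n - m))
    (fun n m => by rw [← resonance_symm n m]; exact hc n (n - m)) hp0 hp hp' hq hq'
    (fun n => (S' n).image fun m => n - m)
  refine h.of_norm_le fun n => le_of_eq ?_
  rw [Finset.sum_image (fun x _ y _ h => by simpa using h)]
  simp only [sub_sub_cancel]
  congr 2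
  exact Finset.sum_congr rfl fun m _ => by ring

section

/-! ### The nonlinearity in the interaction representation -/

/-- The oscillating factor `e^{iθk}`. -/
noncomputable def phase (θ : ℝ) (k : ℤ) : ℂ := Complex.exp (Complex.I * ((k : ℝ) : ℂ) * θ)

theorem norm_phase (θ : ℝ) (k : ℤ) : ‖phase θ k‖ = 1 := by
  rw [phase, show Complex.I * ((k : ℝ) : ℂ) * θ = ((k * θ : ℝ) : ℂ) * Complex.I by
    push_cast; ring, Complex.norm_exp_ofReal_mul_I]

theorem continuous_phase (k : ℤ) : Continuous fun θ => phase θ k := by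
  unfold phase; fun_prop

/-- The bilinear form `in ∑_m e^{iθΩ(n,m)} a_m b_{n-m}`. -/
noncomputable def nonlin (θ : ℝ) (a b : ℤ → ℂ) (n : ℤ) : ℂ :=
  Complex.I * n * ∑' m, phase θ (resonance n m) * (a m * b (n - m))

section Nonlin

variable {θ A B A' B' s : ℝ} {a b a' b' : ℤ → ℂ}

theorem summable_nonlin (θ : ℝ) (ha : SobolevBound 0 A a) (hb : SobolevBound 0 B b) (n : ℤ) :
    Summable fun m => phase θ (resonance n m) * (a m * b (n - m)) :=
  Summable.of_norm (by simpa [norm_phase] using summable_norm_mul ha hb n)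

theorem nonlin_comm (θ : ℝ) (a b : ℤ → ℂ) : nonlin θ a b = nonlin θ b a := by
  funext n
  unfold nonlin
  rw [← (Equiv.subLeft n).tsum_eq]
  congr 1
  refine tsum_congr fun m => ?_
  simp only [Equiv.subLeft_apply, resonance_symm, sub_sub_cancel]
  ring

theorem nonlin_sub_left (θ : ℝ) (ha : SobolevBound 0 A a) (ha' : SobolevBound 0 A' a')
    (hb : SobolevBound 0 B b) (n : ℤ) :
    nonlin θ (fun m => a m - a' m) b n = nonlin θ a b n - nonlin θ a' b n := by
  unfold nonlin
  rw [← mul_sub, ← (summable_nonlin θ ha hb n).tsum_sub (summable_nonlin θ ha' hb n)]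
  congr 1
  exact tsum_congr fun m => by ring

theorem nonlin_sub_right (θ : ℝ) (ha : SobolevBound 0 A a) (hb : SobolevBound 0 B b)
    (hb' : SobolevBound 0 B' b') (n : ℤ) :
    nonlin θ a (fun m => b m - b' m) n = nonlin θ a b n - nonlin θ a b' n := by
  rw [nonlin_comm, nonlin_sub_left θ hb hb' ha, nonlin_comm θ b, nonlin_comm θ b']

theorem nonlin_add_right (θ : ℝ) (ha : SobolevBound 0 A a) (hb : SobolevBound 0 B b)
    (hb' : SobolevBound 0 B' b') (n : ℤ) :
    nonlin θ a (fun m => b m + b' m) n = nonlin θ a b n + nonlin θ a b' n := by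
  have h := nonlin_sub_right θ ha hb hb'.neg n
  have h' := nonlin_sub_right θ ha (SobolevBound.zero 0) hb' n
  simp only [sub_neg_eq_add, zero_sub] at h h'
  rw [h, h']
  simp [nonlin]

/-- Polarization `a² - b² = (a - b)(a + b)`, which turns estimates of differences into bilinear
ones. -/
theorem nonlin_self_sub_self (θ : ℝ) (ha : SobolevBound 0 A a) (hb : SobolevBound 0 B b) (n : ℤ) :
    nonlin θ a a n - nonlin θ b b n =
      nonlin θ (fun m => a m - b m) (fun m => a m + b m) n := by
  rw [nonlin_add_right θ (ha.sub hb) ha hb, nonlin_sub_left θ ha hb ha, nonlin_sub_left θ ha hb hb,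
    nonlin_comm θ b a]
  ring

/-- The phases have modulus one and Cauchy–Schwarz bounds the convolution uniformly in `n`. Thus the
time derivative of any `L²` solution is automatically one derivative of a bounded sequence. -/
theorem nonlin_derivBound (θ : ℝ) (hs : 0 ≤ s) {A₀ B₀ : ℝ} (ha : SobolevBound s A a)
    (ha' : SobolevBound 0 A₀ a) (hb : SobolevBound s B b) (hb' : SobolevBound 0 B₀ b) :
    DerivBound s (2 ^ s * (A * B₀ + A₀ * B)) (nonlin θ a b) := by
  have h1 := ha.1
  have h2 := hb.1
  have h3 := ha'.1
  have h4 := hb'.1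
  refine ⟨by positivity, fun n => ?_⟩
  have hbs := bracket_rpow_pos n s
  unfold nonlin
  rw [norm_mul, norm_mul, Complex.norm_I, one_mul, Complex.norm_intCast, mul_left_comm]
  refine mul_le_mul_of_nonneg_left ?_ (abs_nonneg _)
  rw [← le_div_iff₀' hbs]
  have hsum := summable_norm_mul ha' hb' n
  refine (norm_tsum_le_tsum_norm (by simpa [norm_phase] using hsum)).trans ?_
  refine Real.tsum_le_of_sum_le (fun m => norm_nonneg _) fun S => ?_
  rw [le_div_iff₀' hbs, Finset.mul_sum]
  have w1 : SobolevBound 0 A (fun m => ((bracket m ^ s : ℝ) : ℂ) * a m) :=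
    ⟨h1, fun S => by simpa [abs_of_pos (bracket_rpow_pos _ s)] using ha.2 S⟩
  have w2 : SobolevBound 0 B (fun m => ((bracket m ^ s : ℝ) : ℂ) * b m) :=
    ⟨h2, fun S => by simpa [abs_of_pos (bracket_rpow_pos _ s)] using hb.2 S⟩
  have e1 := sum_norm_mul_le w1 hb' n S
  have e2 := sum_norm_mul_le ha' w2 n S
  simp only [norm_mul, Complex.norm_real, Real.norm_eq_abs,
    abs_of_pos (bracket_rpow_pos _ s)] at e1 e2
  calc _ ≤ ∑ m ∈ S, 2 ^ s * (bracket m ^ s * ‖a m‖ * ‖b (n - m)‖ +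
        ‖a m‖ * (bracket (n - m : ℤ) ^ s * ‖b (n - m)‖)) := by
        refine Finset.sum_le_sum fun m _ => ?_
        have hadd : bracket n ^ s ≤ 2 ^ s * (bracket m ^ s + bracket (n - m : ℤ) ^ s) := by
          have := bracket_add_rpow_le (m : ℝ) ((n - m : ℤ) : ℝ) hs
          simpa using this
        rw [norm_mul, norm_mul, norm_phase, one_mul]
        calc _ ≤ (2 ^ s * (bracket m ^ s + bracket (n - m : ℤ) ^ s)) * (‖a m‖ * ‖b (n - m)‖) := by
              gcongr
          _ = _ := by ring
    _ ≤ _ := by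
        rw [← Finset.mul_sum, Finset.sum_add_distrib]
        gcongr

theorem norm_nonlin_le (θ : ℝ) (ha : SobolevBound 0 A a) (hb : SobolevBound 0 B b) (n : ℤ) :
    ‖nonlin θ a b n‖ ≤ |(n : ℝ)| * (2 * (A * B)) := by
  have h := (nonlin_derivBound θ le_rfl ha ha hb hb).norm_le n
  rw [Real.rpow_zero, one_mul, ← two_mul] at h
  exact h

theorem continuous_nonlin (ha : SobolevBound 0 A a) (hb : SobolevBound 0 B b) (n : ℤ) :
    Continuous fun θ => nonlin θ a b n := by
  unfold nonlin
  refine continuous_const.mul (continuous_tsum (fun m => (continuous_phase _).mul continuous_const)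
    (summable_norm_mul ha hb n) fun m θ => ?_)
  rw [norm_mul, norm_phase, one_mul, norm_mul]

end Nonlin

/-! ### Continuity in time with values in `H^s` -/

/-- Continuity on `J` with values in `H^s`, for families of coefficient sequences. -/
def SobolevContinuousOn (s : ℝ) (J : Set ℝ) (a : ℝ → ℤ → ℂ) : Prop :=
  (∀ t ∈ J, ∃ M, SobolevBound s M (a t)) ∧
    ∀ t ∈ J, ∀ ε > 0, ∀ᶠ r in 𝓝[J] t, SobolevBound s ε (fun n => a r n - a t n)

namespace SobolevContinuousOn

variable {s : ℝ} {J J' : Set ℝ} {a b : ℝ → ℤ → ℂ} {w : ℝ → ℝ}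

theorem mono (h : SobolevContinuousOn s J a) (hJ : J' ⊆ J) : SobolevContinuousOn s J' a :=
  ⟨fun t ht => h.1 t (hJ ht), fun t ht ε hε =>
    (h.2 t (hJ ht) ε hε).filter_mono (nhdsWithin_mono t hJ)⟩

theorem of_le_order {s' : ℝ} (h : SobolevContinuousOn s J a) (hs : s' ≤ s) :
    SobolevContinuousOn s' J a :=
  ⟨fun t ht => (h.1 t ht).imp fun _ hM => hM.of_le_order hs, fun t ht ε hε =>
    (h.2 t ht ε hε).mono fun _ hr => hr.of_le_order hs⟩

theorem congr (h : SobolevContinuousOn s J a) (hab : ∀ t ∈ J, b t = a t) :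
    SobolevContinuousOn s J b := by
  refine ⟨fun t ht => by rw [hab t ht]; exact h.1 t ht, fun t ht ε hε => ?_⟩
  filter_upwards [h.2 t ht ε hε, self_mem_nhdsWithin] with r hr hrJ
  rwa [hab t ht, hab r hrJ]

theorem continuousOn_coeff (h : SobolevContinuousOn s J a) (n : ℤ) :
    ContinuousOn (fun t => a t n) J := by
  intro t ht
  rw [ContinuousWithinAt, Metric.tendsto_nhds]
  intro ε hε
  have hb := bracket_rpow_pos n s
  filter_upwards [h.2 t ht (bracket n ^ s * (ε / 2)) (by positivity)] with r hr
  have := hr.le n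
  rw [dist_eq_norm]
  have := le_of_mul_le_mul_left this hb
  linarith

theorem add (ha : SobolevContinuousOn s J a) (hb : SobolevContinuousOn s J b) :
    SobolevContinuousOn s J (fun t n => a t n + b t n) := by
  refine ⟨fun t ht => ?_, fun t ht ε hε => ?_⟩
  · obtain ⟨M, hM⟩ := ha.1 t ht
    obtain ⟨M', hM'⟩ := hb.1 t ht
    exact ⟨_, hM.add hM'⟩
  · filter_upwards [ha.2 t ht (ε / 2) (by positivity), hb.2 t ht (ε / 2) (by positivity)]
      with r h1 h2
    have := h1.add h2
    rw [add_halves] at this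
    refine this.of_norm_le fun n => le_of_eq (by congr 1; ring)

theorem sub (ha : SobolevContinuousOn s J a) (hb : SobolevContinuousOn s J b) :
    SobolevContinuousOn s J (fun t n => a t n - b t n) := by
  have hb' : SobolevContinuousOn s J (fun t n => -b t n) :=
    ⟨fun t ht => (hb.1 t ht).imp fun _ h => h.neg, fun t ht ε hε =>
      (hb.2 t ht ε hε).mono fun r hr => hr.neg.of_norm_le fun n => le_of_eq (by congr 1; ring)⟩
  simpa [sub_eq_add_neg] using ha.add hb'

theorem const {c : ℤ → ℂ} {M : ℝ} (hc : SobolevBound s M c) :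
    SobolevContinuousOn s J (fun _ => c) :=
  ⟨fun _ _ => ⟨M, hc⟩, fun _ _ ε hε => Eventually.of_forall fun _ =>
    ((SobolevBound.zero s).mono hε.le).of_norm_le fun n => by simp⟩

theorem exists_bound_eventually (h : SobolevContinuousOn s J a) {t : ℝ} (ht : t ∈ J) :
    ∃ M, ∀ᶠ r in 𝓝[J] t, SobolevBound s M (a r) := by
  obtain ⟨M, hM⟩ := h.1 t ht
  refine ⟨1 + M, (h.2 t ht 1 one_pos).mono fun r hr => ?_⟩
  exact (hr.add hM).of_norm_le fun n => le_of_eq (by congr 1; ring)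

theorem exists_bound (h : SobolevContinuousOn s J a) (hJ : IsCompact J) :
    ∃ M, 0 ≤ M ∧ ∀ t ∈ J, SobolevBound s M (a t) := by
  refine hJ.induction_on (p := fun K => ∃ M, 0 ≤ M ∧ ∀ t ∈ K, SobolevBound s M (a t))
    ⟨0, le_rfl, fun t ht => ht.elim⟩ ?_ ?_ ?_
  · rintro K K' hK ⟨M, h0, hM⟩
    exact ⟨M, h0, fun t ht => hM t (hK ht)⟩
  · rintro K K' ⟨M, h0, hM⟩ ⟨M', h0', hM'⟩
    refine ⟨max M M', le_max_of_le_left h0, fun t ht => ?_⟩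
    rcases ht with ht | ht
    · exact (hM t ht).mono (le_max_left _ _)
    · exact (hM' t ht).mono (le_max_right _ _)
  · intro t ht
    obtain ⟨M, hM⟩ := h.exists_bound_eventually ht
    exact ⟨_, hM, |M|, abs_nonneg _, fun r hr => SobolevBound.mono hr (le_abs_self M)⟩

theorem continuousOn_nonlin (ha : SobolevContinuousOn 0 J a) (hb : SobolevContinuousOn 0 J b)
    (hw : ContinuousOn w J) (n : ℤ) :
    ContinuousOn (fun t => nonlin (w t) (a t) (b t) n) J := by
  intro t ht
  obtain ⟨A, hA⟩ := ha.1 t ht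
  obtain ⟨B, hB⟩ := hb.1 t ht
  rw [ContinuousWithinAt, Metric.tendsto_nhds]
  intro η hη
  -- Total error when `a`, `b` and the phase are replaced in turn, each with tolerance `ε`; it
  -- vanishes with `ε`, which selects a suitable tolerance.
  have hlim : Tendsto (fun ε : ℝ => |(n : ℝ)| * (2 * (ε * (ε + B))) + |(n : ℝ)| * (2 * (A * ε)) + ε)
      (𝓝[>] 0) (𝓝 0) := by
    have : Continuous fun ε : ℝ =>
      |(n : ℝ)| * (2 * (ε * (ε + B))) + |(n : ℝ)| * (2 * (A * ε)) + ε := by fun_prop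
    simpa using (this.tendsto 0).mono_left nhdsWithin_le_nhds
  obtain ⟨ε, hεη, hε⟩ := ((hlim.eventually (gt_mem_nhds hη)).and self_mem_nhdsWithin).exists
  have hε : 0 < ε := hε
  have hθ : Tendsto (fun r => nonlin (w r) (a t) (b t) n) (𝓝[J] t)
      (𝓝 (nonlin (w t) (a t) (b t) n)) :=
    ((continuous_nonlin hA hB n).tendsto (w t)).comp (hw t ht)
  filter_upwards [ha.2 t ht ε hε, hb.2 t ht ε hε, Metric.tendsto_nhds.1 hθ ε hε] with r h1 h2 h3
  have hAr : SobolevBound 0 (ε + A) (a r) :=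
    (h1.add hA).of_norm_le fun n => le_of_eq (by congr 1; ring)
  have hBr : SobolevBound 0 (ε + B) (b r) :=
    (h2.add hB).of_norm_le fun n => le_of_eq (by congr 1; ring)
  have e1 := norm_nonlin_le (w r) h1 hBr n
  have e2 := norm_nonlin_le (w r) hA h2 n
  rw [nonlin_sub_left _ hAr hA hBr] at e1
  rw [nonlin_sub_right _ hA hBr hB] at e2
  rw [dist_eq_norm] at h3 ⊢
  calc _ = ‖(nonlin (w r) (a r) (b r) n - nonlin (w r) (a t) (b r) n) +
        (nonlin (w r) (a t) (b r) n - nonlin (w r) (a t) (b t) n) +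
        (nonlin (w r) (a t) (b t) n - nonlin (w t) (a t) (b t) n)‖ := by congr 1; ring
    _ ≤ _ := norm_add₃_le
    _ < η := by linarith

end SobolevContinuousOn

/-! ### Integration in time -/

theorem hasDerivAt_primitive {f : ℝ → ℂ} {r t x : ℝ} (hf : ContinuousOn f (Icc r t))
    (hx : x ∈ Ioo r t) : HasDerivAt (fun y => ∫ τ in r..y, f τ) (f x) x := by
  refine intervalIntegral.integral_hasDerivAt_right
    ((hf.mono (Icc_subset_Icc_right hx.2.le)).intervalIntegrable_of_Icc hx.1.le)
    ((hf.mono Ioo_subset_Icc_self).stronglyMeasurableAtFilter isOpen_Ioo x hx)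
    (hf.continuousAt (Icc_mem_nhds hx.1 hx.2))

theorem continuousOn_primitive {f : ℝ → ℂ} {r t : ℝ} (hrt : r ≤ t) (hf : ContinuousOn f (Icc r t)) :
    ContinuousOn (fun y => ∫ τ in r..y, f τ) (Icc r t) := by
  have := intervalIntegral.continuousOn_primitive_interval'
    (hf.intervalIntegrable_of_Icc (μ := volume) hrt) (left_mem_uIcc)
  rwa [uIcc_of_le hrt] at this

/-- The primitive of `g` is normalized to vanish at `r`, so only the boundary term at `t` survives.
-/
theorem integral_mul_eq_primitive_mul_sub {g P P' : ℝ → ℂ} {r t : ℝ} (hrt : r ≤ t)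
    (hg : ContinuousOn g (Icc r t)) (hP : ContinuousOn P (Icc r t))
    (hPP' : ∀ x ∈ Ioo r t, HasDerivAt P (P' x) x) (hP' : ContinuousOn P' (Icc r t)) :
    ∫ τ in r..t, g τ * P τ =
      (∫ τ in r..t, g τ) * P t - ∫ τ in r..t, (∫ x in r..τ, g x) * P' τ := by
  have h := intervalIntegral.integral_mul_deriv_eq_deriv_mul_of_hasDerivAt (a := r) (b := t)
    (u := P) (u' := P') (v := fun y => ∫ x in r..y, g x) (v' := g)
    (by rwa [uIcc_of_le hrt]) (by rw [uIcc_of_le hrt]; exact continuousOn_primitive hrt hg)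
    (by rw [min_eq_left hrt, max_eq_right hrt]; exact hPP')
    (by rw [min_eq_left hrt, max_eq_right hrt]; exact fun x hx => hasDerivAt_primitive hg hx)
    (hP'.intervalIntegrable_of_Icc hrt) (hg.intervalIntegrable_of_Icc hrt)
  simp only [intervalIntegral.integral_same, mul_zero, sub_zero] at h
  simp_rw [mul_comm (g _), mul_comm (∫ x in r..t, g x), mul_comm (∫ x in r.._, g x)]
  exact h

/-- Minkowski's integral inequality, proved by duality: the weighted square sum of the integral is
the integral of its pairing with `g`, and Cauchy–Schwarz bounds this by its own square root times `M
(t - r)`. -/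
theorem SobolevBound.integral {s M r t : ℝ} {g : ℝ → ℤ → ℂ} (hrt : r ≤ t)
    (hg : ∀ n, ContinuousOn (fun τ => g τ n) (Icc r t))
    (hM : ∀ τ ∈ Icc r t, SobolevBound s M (g τ)) :
    SobolevBound s ((t - r) * M) (fun n => ∫ τ in r..t, g τ n) := by
  have hM0 : 0 ≤ M := (hM r (left_mem_Icc.2 hrt)).1
  have htr : 0 ≤ t - r := sub_nonneg.2 hrt
  refine ⟨by positivity, fun S => ?_⟩
  set y : ℤ → ℂ := fun n => ∫ τ in r..t, g τ n with hy
  set Q := ∑ n ∈ S, (bracket n ^ s * ‖y n‖) ^ 2 with hQ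
  have hQ0 : 0 ≤ Q := Finset.sum_nonneg fun _ _ => sq_nonneg _
  have e1 : (Q : ℂ) = ∫ τ in r..t, ∑ n ∈ S,
      (((bracket n ^ s) ^ 2 : ℝ) : ℂ) * (starRingEnd ℂ) (y n) * g τ n := by
    rw [intervalIntegral.integral_finsetSum fun n _ =>
      ((hg n).intervalIntegrable_of_Icc hrt).const_mul _]
    rw [hQ, Complex.ofReal_sum]
    refine Finset.sum_congr rfl fun n _ => ?_
    rw [intervalIntegral.integral_const_mul, mul_assoc, Complex.conj_mul', mul_pow]
    push_cast; ring
  have e2 : ‖(Q : ℂ)‖ ≤ (Real.sqrt Q * M) * |t - r| := by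
    rw [e1]
    refine intervalIntegral.norm_integral_le_of_norm_le_const fun τ hτ => ?_
    rw [uIoc_of_le hrt] at hτ
    refine (norm_sum_le _ _).trans ?_
    have := sum_mul_le_of_sq S (fun n : ℤ => bracket n ^ s * ‖y n‖)
      (fun n : ℤ => bracket n ^ s * ‖g τ n‖)
      (Real.sqrt_nonneg Q) hM0 (by rw [Real.sq_sqrt hQ0]) ((hM τ (Ioc_subset_Icc_self hτ)).2 S)
    refine le_trans (le_of_eq (Finset.sum_congr rfl fun n _ => ?_)) this
    have hb := bracket_rpow_pos n s
    rw [norm_mul, norm_mul, Complex.norm_real, Complex.norm_conj, Real.norm_eq_abs,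
      abs_of_pos (by positivity)]
    ring
  rw [Complex.norm_real, Real.norm_eq_abs, abs_of_nonneg hQ0, abs_of_nonneg htr] at e2
  have hsq := Real.mul_self_sqrt hQ0
  have h3 : Real.sqrt Q ≤ (t - r) * M := by
    rcases (Real.sqrt_nonneg Q).eq_or_lt with h | h
    · rw [← h]; positivity
    · refine le_of_mul_le_mul_left ?_ h
      rw [hsq]; linarith
  rw [← Real.sq_sqrt hQ0]
  exact pow_le_pow_left₀ (Real.sqrt_nonneg _) h3 2

end

section

/-! ### Paths and the normal form estimate -/

/-- `a` is a continuous mean-zero path in `L²` on `[t₀,t₁]` whose Fourier coefficients have the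
continuous time derivatives `F`. -/
structure IsPath (t₀ t₁ : ℝ) (a F : ℝ → ℤ → ℂ) : Prop where
  zero : ∀ t ∈ Icc t₀ t₁, a t 0 = 0
  cont : SobolevContinuousOn 0 (Icc t₀ t₁) a
  contDeriv : ∀ n, ContinuousOn (fun t => F t n) (Icc t₀ t₁)
  eq : ∀ t ∈ Icc t₀ t₁, ∀ n, a t n = a t₀ n + ∫ τ in t₀..t, F τ n

/-- The path has `H^s` norm at most `Y` and, with one derivative less, its time derivative is
bounded by `Y / h`. -/
def HasPathBound (s h Y t₀ t₁ : ℝ) (a F : ℝ → ℤ → ℂ) : Prop :=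
  ∀ t ∈ Icc t₀ t₁, SobolevBound s Y (a t) ∧ DerivBound s (Y / h) (F t)

/-- Decay of the oscillatory integrals over subintervals of `[t₀,t₁]` at integer frequencies. -/
def OscillationBound (ρ γ C t₀ t₁ : ℝ) (w : ℝ → ℝ) : Prop :=
  ∀ r t : ℝ, t₀ ≤ r → r ≤ t → t ≤ t₁ → ∀ k : ℤ,
    ‖∫ x in r..t, phase (w x) k‖ ≤ C * (t - r) ^ γ * bracket k ^ (-ρ)

namespace IsPath

variable {t₀ t₁ r t : ℝ} {a F b G : ℝ → ℤ → ℂ}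

theorem hasDerivAt (h : IsPath t₀ t₁ a F) (n : ℤ) {x : ℝ} (hx : x ∈ Ioo t₀ t₁) :
    HasDerivAt (fun t => a t n) (F x n) x := by
  have h1 := (hasDerivAt_primitive (h.contDeriv n) hx).const_add (a t₀ n)
  refine h1.congr_of_eventuallyEq ?_
  filter_upwards [Ioo_mem_nhds hx.1 hx.2] with y hy
  exact h.eq y (Ioo_subset_Icc_self hy) n

theorem sub_eq_integral (h : IsPath t₀ t₁ a F) (h0 : t₀ ≤ r) (hrt : r ≤ t) (h1 : t ≤ t₁) (n : ℤ) :
    a t n - a r n = ∫ τ in r..t, F τ n := by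
  rw [h.eq t ⟨h0.trans hrt, h1⟩, h.eq r ⟨h0, hrt.trans h1⟩, add_sub_add_left_eq_sub,
    intervalIntegral.integral_interval_sub_left]
  · exact ((h.contDeriv n).mono (Icc_subset_Icc_right h1)).intervalIntegrable_of_Icc (h0.trans hrt)
  · exact ((h.contDeriv n).mono
      (Icc_subset_Icc_right (hrt.trans h1))).intervalIntegrable_of_Icc h0

theorem restrict (h : IsPath t₀ t₁ a F) (h0 : t₀ ≤ r) (h1 : t ≤ t₁) : IsPath r t a F where
  zero x hx := h.zero x ⟨h0.trans hx.1, hx.2.trans h1⟩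
  cont := h.cont.mono (Icc_subset_Icc h0 h1)
  contDeriv n := (h.contDeriv n).mono (Icc_subset_Icc h0 h1)
  eq x hx n := by
    rw [← h.sub_eq_integral h0 hx.1 (hx.2.trans h1)]; ring

theorem sub (ha : IsPath t₀ t₁ a F) (hb : IsPath t₀ t₁ b G) :
    IsPath t₀ t₁ (fun t n => a t n - b t n) (fun t n => F t n - G t n) where
  zero x hx := by simp [ha.zero x hx, hb.zero x hx]
  cont := ha.cont.sub hb.cont
  contDeriv n := (ha.contDeriv n).sub (hb.contDeriv n)
  eq x hx n := by
    rw [intervalIntegral.integral_sub, ha.eq x hx, hb.eq x hx]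
    · ring
    · exact ((ha.contDeriv n).mono (Icc_subset_Icc_right hx.2)).intervalIntegrable_of_Icc hx.1
    · exact ((hb.contDeriv n).mono (Icc_subset_Icc_right hx.2)).intervalIntegrable_of_Icc hx.1

theorem add (ha : IsPath t₀ t₁ a F) (hb : IsPath t₀ t₁ b G) :
    IsPath t₀ t₁ (fun t n => a t n + b t n) (fun t n => F t n + G t n) where
  zero x hx := by simp [ha.zero x hx, hb.zero x hx]
  cont := ha.cont.add hb.cont
  contDeriv n := (ha.contDeriv n).add (hb.contDeriv n)
  eq x hx n := by
    rw [intervalIntegral.integral_add, ha.eq x hx, hb.eq x hx]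
    · ring
    · exact ((ha.contDeriv n).mono (Icc_subset_Icc_right hx.2)).intervalIntegrable_of_Icc hx.1
    · exact ((hb.contDeriv n).mono (Icc_subset_Icc_right hx.2)).intervalIntegrable_of_Icc hx.1

theorem const {c : ℤ → ℂ} {M : ℝ} (hc : SobolevBound 0 M c) (h0 : c 0 = 0) :
    IsPath t₀ t₁ (fun _ => c) (fun _ _ => 0) where
  zero _ _ := h0
  cont := .const hc
  contDeriv _ := continuousOn_const
  eq _ _ _ := by simp

end IsPath

namespace HasPathBound

variable {s h Y Y' t₀ t₁ r t : ℝ} {a F b G : ℝ → ℤ → ℂ}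

theorem restrict (ha : HasPathBound s h Y t₀ t₁ a F) (h0 : t₀ ≤ r) (h1 : t ≤ t₁) :
    HasPathBound s h Y r t a F :=
  fun x hx => ha x ⟨h0.trans hx.1, hx.2.trans h1⟩

theorem add (ha : HasPathBound s h Y t₀ t₁ a F) (hb : HasPathBound s h Y' t₀ t₁ b G) :
    HasPathBound s h (Y + Y') t₀ t₁ (fun t n => a t n + b t n) (fun t n => F t n + G t n) :=
  fun x hx => ⟨(ha x hx).1.add (hb x hx).1, by
    rw [add_div]; exact (ha x hx).2.add (hb x hx).2⟩

theorem sub (ha : HasPathBound s h Y t₀ t₁ a F) (hb : HasPathBound s h Y' t₀ t₁ b G) :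
    HasPathBound s h (Y + Y') t₀ t₁ (fun t n => a t n - b t n) (fun t n => F t n - G t n) :=
  fun x hx => ⟨(ha x hx).1.sub (hb x hx).1, by
    rw [add_div]; exact (ha x hx).2.sub (hb x hx).2⟩

theorem mono (ha : HasPathBound s h Y t₀ t₁ a F) (hh : 0 < h) (hY : Y ≤ Y') :
    HasPathBound s h Y' t₀ t₁ a F :=
  fun x hx => ⟨(ha x hx).1.mono hY, (ha x hx).2.mono (by gcongr)⟩

end HasPathBound

variable {ρ σ γ s C D H h t₀ t₁ : ℝ} {w : ℝ → ℝ} {a F b G : ℝ → ℤ → ℂ} {Ya Ya₀ Yb Yb₀ : ℝ}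

/-- Integration by parts in time for one interaction. -/
theorem integral_phase_mul {r t : ℝ} (hrt : r ≤ t) (hw : ContinuousOn w (Icc r t))
    (ha : IsPath r t a F) (hb : IsPath r t b G) (k i j : ℤ) :
    ∫ τ in r..t, phase (w τ) k * (a τ i * b τ j) =
      (∫ τ in r..t, phase (w τ) k) * (a t i * b t j) -
        ∫ τ in r..t, (∫ x in r..τ, phase (w x) k) * (F τ i * b τ j + a τ i * G τ j) := by
  have hai := ha.cont.continuousOn_coeff i
  have hbj := hb.cont.continuousOn_coeff j
  exact integral_mul_eq_primitive_mul_sub hrt ((continuous_phase k).comp_continuousOn hw)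
    (hai.mul hbj) (fun x hx => (ha.hasDerivAt i hx).mul (hb.hasDerivAt j hx))
    (((ha.contDeriv i).mul hbj).add (hai.mul (hb.contDeriv j)))

/-- Restricting `m` to a finite set makes the exchange of sum and integral and the integration by
parts elementary, while the bound does not depend on the set. The 3 counts one boundary term and two
terms in which the time derivative hits one factor. -/
theorem truncated_normal_form_bound {r t : ℝ} (hH : IsKernelBound σ ρ H) (hs : 0 ≤ s) (hD : 0 ≤ D)
    (hh : 0 < h) (hrt : r ≤ t) (hth : t - r ≤ h) (hw : ContinuousOn w (Icc r t))
    (hΦ : ∀ τ ∈ Icc r t, ∀ k : ℤ, ‖∫ x in r..τ, phase (w x) k‖ ≤ D * bracket k ^ (-ρ))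
    (ha : IsPath r t a F) (hb : IsPath r t b G)
    (hYa : HasPathBound s h Ya r t a F) (hYa₀ : HasPathBound 0 h Ya₀ r t a F)
    (hYb : HasPathBound s h Yb r t b G) (hYb₀ : HasPathBound 0 h Yb₀ r t b G) (S : Finset ℤ) :
    SobolevBound (s + σ) (3 * (D * H * 2 ^ s * (Ya * Yb₀ + Ya₀ * Yb)))
      (fun n => ∫ τ in r..t, Complex.I * n *
        ∑ m ∈ S, phase (w τ) (resonance n m) * (a τ m * b τ (n - m))) := by
  have ht : t ∈ Icc r t := right_mem_Icc.2 hrt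
  have p1 := (hYa t ht).1.1
  have p2 := (hYb t ht).1.1
  have p3 := (hYa₀ t ht).1.1
  have p4 := (hYb₀ t ht).1.1
  have hH0 := hH.1
  set E := D * H * 2 ^ s * (Ya * Yb₀ + Ya₀ * Yb) with hE
  have hE0 : 0 ≤ E := by positivity
  have hbd : SobolevBound (s + σ) E (fun n => Complex.I * n * ∑ m ∈ S,
      (∫ x in r..t, phase (w x) (resonance n m)) * (a t m * b t (n - m))) :=
    hH.sobolevBound (S' := fun _ => S) hs hD (fun n m => hΦ t ht (resonance n m)) (ha.zero t ht)
      (hYa t ht).1 (hYa₀ t ht).1 ((hYb t ht).1.derivBound (hb.zero t ht))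
      ((hYb₀ t ht).1.derivBound (hb.zero t ht))
  -- The derivative bounds carry a factor `1 / h`; integration over an interval of length at most
  -- `h` removes it.
  have hQ : ∀ τ ∈ Icc r t, SobolevBound (s + σ) (2 * E / h) (fun n => Complex.I * n * ∑ m ∈ S,
      (∫ x in r..τ, phase (w x) (resonance n m)) *
        (F τ m * b τ (n - m) + a τ m * G τ (n - m))) := by
    intro τ hτ
    have q1 := hH.sobolevBound' (S' := fun _ => S) hs hD
      (fun n m => hΦ τ hτ (resonance n m)) (hb.zero τ hτ)
      (hYb τ hτ).1 (hYb₀ τ hτ).1 (hYa τ hτ).2 (hYa₀ τ hτ).2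
    have q2 := hH.sobolevBound (S' := fun _ => S) hs hD
      (fun n m => hΦ τ hτ (resonance n m)) (ha.zero τ hτ)
      (hYa τ hτ).1 (hYa₀ τ hτ).1 (hYb τ hτ).2 (hYb₀ τ hτ).2
    have e : D * H * 2 ^ s * (Yb * (Ya₀ / h) + Yb₀ * (Ya / h)) +
        D * H * 2 ^ s * (Ya * (Yb₀ / h) + Ya₀ * (Yb / h)) = 2 * E / h := by
      rw [hE]; field_simp; ring
    rw [← e]
    refine (q1.add q2).of_norm_le fun n => le_of_eq ?_
    rw [← mul_add, ← Finset.sum_add_distrib]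
    congr 2
    exact Finset.sum_congr rfl fun m _ => by ring
  have hphase : ∀ k : ℤ, ContinuousOn (fun τ => phase (w τ) k) (Icc r t) :=
    fun k => (continuous_phase k).comp_continuousOn hw
  have hcQ : ∀ n m : ℤ, ContinuousOn (fun τ => (∫ x in r..τ, phase (w x) (resonance n m)) *
      (F τ m * b τ (n - m) + a τ m * G τ (n - m))) (Icc r t) := fun n m =>
    (continuousOn_primitive hrt (hphase _)).mul
      (((ha.contDeriv m).mul (hb.cont.continuousOn_coeff _)).add
        ((ha.cont.continuousOn_coeff m).mul (hb.contDeriv _)))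
  have hint := SobolevBound.integral hrt
    (fun n => continuousOn_const.mul (continuousOn_finsetSum S fun m _ => hcQ n m)) hQ
  have hle : E + (t - r) * (2 * E / h) ≤ 3 * E := by
    have : (t - r) * (2 * E / h) ≤ 2 * E := by
      rw [← mul_div_assoc, div_le_iff₀ hh]; nlinarith
    linarith
  refine ((hbd.sub hint).mono hle).of_norm_le fun n => le_of_eq ?_
  congr 1
  simp only [Pi.mul_apply, intervalIntegral.integral_const_mul]
  rw [← mul_sub, intervalIntegral.integral_finsetSum, intervalIntegral.integral_finsetSum,
    ← Finset.sum_sub_distrib]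
  · congr 1
    exact Finset.sum_congr rfl fun m _ => integral_phase_mul hrt hw ha hb _ _ _
  · exact fun m _ => (hcQ n m).intervalIntegrable_of_Icc hrt
  · exact fun m _ => ContinuousOn.intervalIntegrable_of_Icc hrt ((hphase _).mul
      ((ha.cont.continuousOn_coeff m).mul (hb.cont.continuousOn_coeff _)))

/-- The normal form estimate: the time integral of the nonlinearity gains `σ < ρ - 5/2`
derivatives. -/
theorem normal_form_bound {r t : ℝ} (hH : IsKernelBound σ ρ H) (hs : 0 ≤ s) (hD : 0 ≤ D)
    (hh : 0 < h) (hrt : r ≤ t) (hth : t - r ≤ h) (hw : ContinuousOn w (Icc r t))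
    (hΦ : ∀ τ ∈ Icc r t, ∀ k : ℤ, ‖∫ x in r..τ, phase (w x) k‖ ≤ D * bracket k ^ (-ρ))
    (ha : IsPath r t a F) (hb : IsPath r t b G)
    (hYa : HasPathBound s h Ya r t a F) (hYa₀ : HasPathBound 0 h Ya₀ r t a F)
    (hYb : HasPathBound s h Yb r t b G) (hYb₀ : HasPathBound 0 h Yb₀ r t b G) :
    SobolevBound (s + σ) (3 * (D * H * 2 ^ s * (Ya * Yb₀ + Ya₀ * Yb)))
      (fun n => ∫ τ in r..t, nonlin (w τ) (a τ) (b τ) n) := by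
  -- The truncation is removed coefficientwise, by dominated convergence under the convolution bound
  -- `|n| Ya₀ Yb₀`.
  refine SobolevBound.of_tendsto (l := (atTop : Filter (Finset ℤ)))
    (Eventually.of_forall fun S =>
      truncated_normal_form_bound hH hs hD hh hrt hth hw hΦ ha hb hYa hYa₀ hYb hYb₀ S) fun n => ?_
  have hphase : ∀ k : ℤ, ContinuousOn (fun τ => phase (w τ) k) (Icc r t) :=
    fun k => (continuous_phase k).comp_continuousOn hw
  refine intervalIntegral.tendsto_integral_filter_of_dominated_convergence
    (fun _ => |(n : ℝ)| * (Ya₀ * Yb₀)) ?_ ?_ (by simp) ?_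
  · refine Eventually.of_forall fun S => ?_
    rw [uIoc_of_le hrt]
    refine (ContinuousOn.mono (continuousOn_const.mul (continuousOn_finsetSum S fun m _ =>
      (hphase _).mul ((ha.cont.continuousOn_coeff m).mul
        (hb.cont.continuousOn_coeff _)))) Ioc_subset_Icc_self).aestronglyMeasurable
      measurableSet_Ioc
  · refine Eventually.of_forall fun S => Eventually.of_forall fun τ hτ => ?_
    rw [uIoc_of_le hrt] at hτ
    have hτ' := Ioc_subset_Icc_self hτ
    rw [norm_mul, norm_mul, Complex.norm_I, one_mul, Complex.norm_intCast]
    refine mul_le_mul_of_nonneg_left ?_ (abs_nonneg _)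
    refine (norm_sum_le _ _).trans ?_
    simpa [norm_phase] using sum_norm_mul_le (hYa₀ τ hτ').1 (hYb₀ τ hτ').1 n S
  · refine Eventually.of_forall fun τ hτ => ?_
    rw [uIoc_of_le hrt] at hτ
    have hτ' := Ioc_subset_Icc_self hτ
    exact ((summable_nonlin (w τ) (hYa₀ τ hτ').1 (hYb₀ τ hτ').1 n).hasSum).const_mul _

/-- The normal form estimate on subintervals, as a Hölder bound in time. -/
theorem OscillationBound.normal_form {r t : ℝ} (hΦ : OscillationBound ρ γ C t₀ t₁ w)
    (hH : IsKernelBound σ ρ H) (hs : 0 ≤ s) (hC : 0 ≤ C) (hγ : 0 ≤ γ) (hh : 0 < h)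
    (h0 : t₀ ≤ r) (hrt : r ≤ t) (h1 : t ≤ t₁) (hth : t - r ≤ h)
    (hw : ContinuousOn w (Icc t₀ t₁)) (ha : IsPath t₀ t₁ a F) (hb : IsPath t₀ t₁ b G)
    (hYa : HasPathBound s h Ya t₀ t₁ a F) (hYa₀ : HasPathBound 0 h Ya₀ t₀ t₁ a F)
    (hYb : HasPathBound s h Yb t₀ t₁ b G) (hYb₀ : HasPathBound 0 h Yb₀ t₀ t₁ b G) :
    SobolevBound (s + σ) (3 * C * H * 2 ^ s * (Ya * Yb₀ + Ya₀ * Yb) * (t - r) ^ γ)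
      (fun n => ∫ τ in r..t, nonlin (w τ) (a τ) (b τ) n) := by
  have htr : 0 ≤ t - r := sub_nonneg.2 hrt
  -- Every primitive on `[r, τ]` with `τ ≤ t` obeys the bound with `(t - r)^γ`, since `γ ≥ 0`.
  have := normal_form_bound (D := C * (t - r) ^ γ) hH hs (by positivity) hh hrt hth
    (hw.mono (Icc_subset_Icc h0 h1))
    (fun τ hτ k => (hΦ r τ h0 hτ.1 (hτ.2.trans h1) k).trans (by
      have := bracket_rpow_pos k (-ρ)
      have h3 : 0 ≤ τ - r := sub_nonneg.2 hτ.1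
      have h4 := hτ.2
      gcongr))
    (ha.restrict h0 h1) (hb.restrict h0 h1) (hYa.restrict h0 h1) (hYa₀.restrict h0 h1)
    (hYb.restrict h0 h1) (hYb₀.restrict h0 h1)
  refine this.mono (le_of_eq ?_)
  ring

end

section

/-! ### Local theory in the interaction representation -/

/-- Hypotheses on the modulation and constants which make the normal form estimate available. -/
structure IsAdmissible (ρ γ C H t₀ t₁ : ℝ) (w : ℝ → ℝ) : Prop where
  γ_pos : 0 < γ
  C_nonneg : 0 ≤ C
  cont : ContinuousOn w (Icc t₀ t₁)
  osc : OscillationBound ρ γ C t₀ t₁ w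
  kernel : IsKernelBound 0 ρ H

theorem IsAdmissible.restrict {ρ γ C H t₀ t₁ r t : ℝ} {w : ℝ → ℝ}
    (h : IsAdmissible ρ γ C H t₀ t₁ w) (h0 : t₀ ≤ r) (h1 : t ≤ t₁) :
    IsAdmissible ρ γ C H r t w where
  γ_pos := h.γ_pos
  C_nonneg := h.C_nonneg
  cont := h.cont.mono (Icc_subset_Icc h0 h1)
  osc r' t' hr hrt ht := h.osc r' t' (h0.trans hr) hrt (ht.trans h1)
  kernel := h.kernel

/-- The constant of the bilinear Duhamel estimate on an interval of length `h`. -/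
noncomputable def duhamelConst (γ C H s h : ℝ) : ℝ := 3 * C * H * 2 ^ s * h ^ γ + 2 ^ s * h

theorem duhamelConst_mono_order {γ C H s s' h : ℝ} (hC : 0 ≤ C) (hH : 0 ≤ H) (hh : 0 ≤ h)
    (hs : s ≤ s') : duhamelConst γ C H s h ≤ duhamelConst γ C H s' h := by
  unfold duhamelConst
  have : (2 : ℝ) ^ s ≤ 2 ^ s' := Real.rpow_le_rpow_of_exponent_le (by norm_num) hs
  gcongr

theorem duhamelConst_nonneg {γ C H s h : ℝ} (hC : 0 ≤ C) (hH : 0 ≤ H) (hh : 0 ≤ h) :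
    0 ≤ duhamelConst γ C H s h := by
  unfold duhamelConst; positivity

theorem exists_small_duhamelConst {γ : ℝ} (hγ : 0 < γ) (C H s X : ℝ) {T : ℝ} (hT : 0 < T) :
    ∃ h, 0 < h ∧ h ≤ T ∧ duhamelConst γ C H s h * X ≤ 1 := by
  have hc : Continuous fun h : ℝ => duhamelConst γ C H s h * X := by
    unfold duhamelConst
    have := Real.continuous_rpow_const hγ.le
    fun_prop
  have hlim : Tendsto (fun h : ℝ => duhamelConst γ C H s h * X) (𝓝[>] 0) (𝓝 0) := by
    have := (hc.tendsto 0).mono_left (nhdsWithin_le_nhds (s := Ioi 0))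
    simpa [duhamelConst, Real.zero_rpow hγ.ne'] using this
  obtain ⟨h, h1, h2⟩ := ((hlim.eventually (gt_mem_nhds one_pos)).and
    (Ioc_mem_nhdsGT hT)).exists
  exact ⟨h, h2.1, h2.2, h1.le⟩

theorem sobolevContinuousOn_of_holder {s E γ : ℝ} {J : Set ℝ} {a : ℝ → ℤ → ℂ} (hγ : 0 < γ)
    (h1 : ∀ t ∈ J, ∃ M, SobolevBound s M (a t))
    (h2 : ∀ r ∈ J, ∀ t ∈ J, r ≤ t → SobolevBound s (E * (t - r) ^ γ) (fun n => a t n - a r n)) :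
    SobolevContinuousOn s J a := by
  refine ⟨h1, fun t ht ε hε => ?_⟩
  have hc : Continuous fun r : ℝ => E * |r - t| ^ γ := by
    have := Real.continuous_rpow_const hγ.le
    fun_prop
  have hlim : Tendsto (fun r : ℝ => E * |r - t| ^ γ) (𝓝[J] t) (𝓝 0) := by
    have := (hc.tendsto t).mono_left (nhdsWithin_le_nhds (s := J))
    simpa [Real.zero_rpow hγ.ne'] using this
  filter_upwards [hlim.eventually (gt_mem_nhds hε), self_mem_nhdsWithin] with r hr hrJ
  rcases le_total t r with h | h
  · rw [abs_of_nonneg (sub_nonneg.2 h)] at hr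
    exact (h2 t ht r hrJ h).mono hr.le
  · rw [abs_sub_comm, abs_of_nonneg (sub_nonneg.2 h)] at hr
    exact ((h2 r hrJ t ht h).mono hr.le).of_norm_le fun n => (norm_sub_rev _ _).le

variable {ρ γ s C H h t₀ t₁ : ℝ} {w : ℝ → ℝ} {a F b G : ℝ → ℤ → ℂ} {Ya Ya₀ Yb Yb₀ : ℝ}

/-- Continuity in `L²` is the point: the integrand loses a derivative, so it has to come from the
Hölder bound of the normal form. -/
theorem isPath_duhamel (hA : IsAdmissible ρ γ C H t₀ t₁ w) (hh : 0 < h) (hth : t₁ - t₀ ≤ h)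
    (ha : IsPath t₀ t₁ a F) (hb : IsPath t₀ t₁ b G)
    (hYa : HasPathBound 0 h Ya t₀ t₁ a F) (hYb : HasPathBound 0 h Yb t₀ t₁ b G) :
    IsPath t₀ t₁ (fun t n => ∫ τ in t₀..t, nonlin (w τ) (a τ) (b τ) n)
      (fun t => nonlin (w t) (a t) (b t)) := by
  have hcN := fun n => ha.cont.continuousOn_nonlin hb.cont hA.cont n
  have key : ∀ r ∈ Icc t₀ t₁, ∀ t ∈ Icc t₀ t₁, r ≤ t →
      SobolevBound 0 (3 * C * H * 2 ^ (0 : ℝ) * (Ya * Yb + Ya * Yb) * (t - r) ^ γ)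
        (fun n => ∫ τ in r..t, nonlin (w τ) (a τ) (b τ) n) := by
    intro r hr t ht hrt
    have := hA.osc.normal_form hA.kernel le_rfl hA.C_nonneg hA.γ_pos.le hh hr.1 hrt ht.2
      (by linarith [hr.1, ht.2]) hA.cont ha hb hYa hYa hYb hYb
    simpa only [add_zero] using this
  refine ⟨fun t _ => by simp [nonlin], ?_, hcN, fun t _ n => by simp⟩
  refine sobolevContinuousOn_of_holder hA.γ_pos
    (fun t ht => ⟨_, key t₀ (left_mem_Icc.2 (ht.1.trans ht.2)) t ht ht.1⟩)
    fun r hr t ht hrt => (key r hr t ht hrt).of_norm_le fun n => le_of_eq ?_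
  rw [intervalIntegral.integral_interval_sub_left]
  · exact ((hcN n).mono (Icc_subset_Icc_right ht.2)).intervalIntegrable_of_Icc ht.1
  · exact ((hcN n).mono (Icc_subset_Icc_right hr.2)).intervalIntegrable_of_Icc hr.1

/-- The two summands of `duhamelConst` correspond to the two halves of the path norm: `h^γ` from the
normal form estimate, and `h` from the direct bound of the time derivative, rescaled by `h`. -/
theorem hasPathBound_duhamel (hA : IsAdmissible ρ γ C H t₀ t₁ w) (hs : 0 ≤ s) (hh : 0 < h)
    (hth : t₁ - t₀ ≤ h) (ha : IsPath t₀ t₁ a F) (hb : IsPath t₀ t₁ b G)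
    (hYa : HasPathBound s h Ya t₀ t₁ a F) (hYa₀ : HasPathBound 0 h Ya₀ t₀ t₁ a F)
    (hYb : HasPathBound s h Yb t₀ t₁ b G) (hYb₀ : HasPathBound 0 h Yb₀ t₀ t₁ b G) :
    HasPathBound s h (duhamelConst γ C H s h * (Ya * Yb₀ + Ya₀ * Yb)) t₀ t₁
      (fun t n => ∫ τ in t₀..t, nonlin (w τ) (a τ) (b τ) n)
      (fun t => nonlin (w t) (a t) (b t)) := by
  intro t ht
  have q1 := (hYa t ht).1.1
  have q2 := (hYa₀ t ht).1.1
  have q3 := (hYb t ht).1.1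
  have q4 := (hYb₀ t ht).1.1
  have hC := hA.C_nonneg
  have hH := hA.kernel.1
  have hγ := hA.γ_pos
  have h0 : 0 ≤ t - t₀ := sub_nonneg.2 ht.1
  have h1 : t - t₀ ≤ h := by linarith [ht.2]
  constructor
  · have := hA.osc.normal_form hA.kernel hs hC hγ.le hh le_rfl ht.1 ht.2 h1 hA.cont
      ha hb hYa hYa₀ hYb hYb₀
    rw [add_zero] at this
    refine this.mono ?_
    calc _ ≤ 3 * C * H * 2 ^ s * (Ya * Yb₀ + Ya₀ * Yb) * h ^ γ := by gcongr
      _ ≤ _ := by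
        unfold duhamelConst
        rw [add_mul]
        refine le_add_of_le_of_nonneg (le_of_eq (by ring)) (by positivity)
  · refine (nonlin_derivBound (w t) hs (hYa t ht).1 (hYa₀ t ht).1 (hYb t ht).1
      (hYb₀ t ht).1).mono ?_
    rw [le_div_iff₀ hh]
    unfold duhamelConst
    rw [add_mul]
    refine le_add_of_nonneg_of_le (by positivity) (le_of_eq (by ring))

theorem HasPathBound.congr {Y : ℝ} (ha : HasPathBound s h Y t₀ t₁ a F)
    (h1 : ∀ t ∈ Icc t₀ t₁, ∀ n, b t n = a t n) (h2 : ∀ t ∈ Icc t₀ t₁, ∀ n, G t n = F t n) :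
    HasPathBound s h Y t₀ t₁ b G := fun t ht => by
  rw [show b t = a t from funext (h1 t ht), show G t = F t from funext (h2 t ht)]
  exact ha t ht

/-- The difference estimate for the quadratic Duhamel term. -/
theorem hasPathBound_duhamel_sub {Z P : ℝ} (hA : IsAdmissible ρ γ C H t₀ t₁ w) (hh : 0 < h)
    (hth : t₁ - t₀ ≤ h) (ha : IsPath t₀ t₁ a F) (hb : IsPath t₀ t₁ b G)
    (hZ : HasPathBound 0 h Z t₀ t₁ (fun t n => a t n - b t n) (fun t n => F t n - G t n))
    (hP : HasPathBound 0 h P t₀ t₁ (fun t n => a t n + b t n) (fun t n => F t n + G t n)) :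
    HasPathBound 0 h (duhamelConst γ C H 0 h * (Z * P + Z * P)) t₀ t₁
      (fun t n => (∫ τ in t₀..t, nonlin (w τ) (a τ) (a τ) n) -
        ∫ τ in t₀..t, nonlin (w τ) (b τ) (b τ) n)
      (fun t n => nonlin (w t) (a t) (a t) n - nonlin (w t) (b t) (b t) n) := by
  have hsub : ∀ t ∈ Icc t₀ t₁, ∀ n, nonlin (w t) (a t) (a t) n - nonlin (w t) (b t) (b t) n =
      nonlin (w t) (fun n => a t n - b t n) (fun n => a t n + b t n) n := by
    intro t ht n
    obtain ⟨A, hA'⟩ := ha.cont.1 t ht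
    obtain ⟨B, hB'⟩ := hb.cont.1 t ht
    exact nonlin_self_sub_self (w t) hA' hB' n
  refine (hasPathBound_duhamel hA le_rfl hh hth (ha.sub hb) (ha.add hb) hZ hZ hP hP).congr
    (fun t ht n => ?_) hsub
  rw [← intervalIntegral.integral_sub]
  · refine intervalIntegral.integral_congr fun τ hτ => ?_
    rw [uIcc_of_le ht.1] at hτ
    exact hsub τ ⟨hτ.1, hτ.2.trans ht.2⟩ n
  · exact ((ha.cont.continuousOn_nonlin ha.cont hA.cont n).mono
      (Icc_subset_Icc_right ht.2)).intervalIntegrable_of_Icc ht.1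
  · exact ((hb.cont.continuousOn_nonlin hb.cont hA.cont n).mono
      (Icc_subset_Icc_right ht.2)).intervalIntegrable_of_Icc ht.1

/-! ### Stability and uniqueness -/

/-- `v` solves the equation in the interaction representation on `[t₀,t₁]`. -/
def IsInteractionSolution (w : ℝ → ℝ) (t₀ t₁ : ℝ) (v : ℝ → ℤ → ℂ) : Prop :=
  IsPath t₀ t₁ v (fun t => nonlin (w t) (v t) (v t))

theorem IsInteractionSolution.restrict {v : ℝ → ℤ → ℂ} {r t : ℝ}
    (hv : IsInteractionSolution w t₀ t₁ v) (h0 : t₀ ≤ r) (h1 : t ≤ t₁) :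
    IsInteractionSolution w r t v := IsPath.restrict hv h0 h1

/-- The source of unconditionality: for a solution the derivative half of the path norm follows from
size bounds alone once `h` is small. -/
theorem hasPathBound_of_sobolevBound {v : ℝ → ℤ → ℂ} {A A₀ : ℝ} (hs : 0 ≤ s) (hh : 0 < h)
    (hA : ∀ t ∈ Icc t₀ t₁, SobolevBound s A (v t)) (hA₀ : ∀ t ∈ Icc t₀ t₁, SobolevBound 0 A₀ (v t))
    (hh' : 2 ^ s * h * (2 * A₀) ≤ 1) :
    HasPathBound s h A t₀ t₁ v (fun t => nonlin (w t) (v t) (v t)) := by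
  refine fun t ht => ⟨hA t ht, (nonlin_derivBound (w t) hs (hA t ht) (hA₀ t ht) (hA t ht)
    (hA₀ t ht)).mono ?_⟩
  rw [le_div_iff₀ hh]
  have := mul_le_mul_of_nonneg_right hh' (hA t ht).1
  linarith

theorem le_duhamelConst (hC : 0 ≤ C) (hH : 0 ≤ H) (hh : 0 ≤ h) :
    2 ^ s * h ≤ duhamelConst γ C H s h := by
  unfold duhamelConst
  have : 0 ≤ 3 * C * H * 2 ^ s * h ^ γ := by positivity
  linarith

/-- The difference of two solutions has path norm `Z` at most `D + κ·4MZ ≤ D + Z/2`, where `κ` is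
the Duhamel constant; hence it is at most `2D`. -/
theorem stability {D M : ℝ} (hA : IsAdmissible ρ γ C H t₀ t₁ w) (hh : 0 < h) (hth : t₁ - t₀ ≤ h)
    (ha : IsInteractionSolution w t₀ t₁ a) (hb : IsInteractionSolution w t₀ t₁ b)
    (hMa : ∀ t ∈ Icc t₀ t₁, SobolevBound 0 M (a t)) (hMb : ∀ t ∈ Icc t₀ t₁, SobolevBound 0 M (b t))
    (hsmall : duhamelConst γ C H 0 h * (8 * M) ≤ 1)
    (hD : SobolevBound 0 D (fun n => a t₀ n - b t₀ n)) :
    ∀ t ∈ Icc t₀ t₁, SobolevBound 0 (2 * D) (fun n => a t n - b t n) := by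
  intro t ht
  have hM0 : 0 ≤ M := (hMa t ht).1
  have hκ := duhamelConst_nonneg (γ := γ) (s := 0) hA.C_nonneg hA.kernel.1 hh.le
  have hκ' : 2 ^ (0 : ℝ) * h * (2 * M) ≤ 1 := by
    have h2 := le_duhamelConst (s := 0) (γ := γ) hA.C_nonneg hA.kernel.1 hh.le
    nlinarith
  have pa := hasPathBound_of_sobolevBound (w := w) le_rfl hh hMa hMa hκ'
  have pb := hasPathBound_of_sobolevBound (w := w) le_rfl hh hMb hMb hκ'
  have hdef : ∀ t ∈ Icc t₀ t₁, ∀ n, a t n - b t n = (a t₀ n - b t₀ n) +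
      ((∫ τ in t₀..t, nonlin (w τ) (a τ) (a τ) n) -
        ∫ τ in t₀..t, nonlin (w τ) (b τ) (b τ) n) := by
    intro t ht n
    rw [IsPath.eq ha t ht n, IsPath.eq hb t ht n]; ring
  have hconst : HasPathBound 0 h D t₀ t₁ (fun _ n => a t₀ n - b t₀ n) (fun _ _ => 0) :=
    fun _ _ => ⟨hD, (DerivBound.zero 0).mono (div_nonneg hD.1 hh.le)⟩
  -- The absorption is carried out by iteration from the crude bound `2M`, since path bounds are
  -- inequalities rather than values of a norm.
  have step : ∀ k : ℕ, HasPathBound 0 h (2 * D + 2 * M * (1 / 2) ^ k) t₀ t₁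
      (fun t n => a t n - b t n)
      (fun t n => nonlin (w t) (a t) (a t) n - nonlin (w t) (b t) (b t) n) := by
    intro k
    induction k with
    | zero => exact (pa.sub pb).mono hh (by linarith [hD.1])
    | succ k ih =>
      have h1 := hasPathBound_duhamel_sub hA hh hth ha hb ih (pa.add pb)
      refine ((hconst.add h1).congr (fun t ht n => hdef t ht n) (fun t ht n => ?_)).mono hh ?_
      · ring
      · have hZ : 0 ≤ 2 * D + 2 * M * (1 / 2) ^ k := by have := hD.1; positivity
        have := mul_le_mul_of_nonneg_right hsmall hZ
        rw [pow_succ]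
        nlinarith
  refine SobolevBound.of_tendsto_bound (l := (atTop : Filter ℕ))
    (Eventually.of_forall fun k => (step k t ht).1) ?_
  have : Tendsto (fun k : ℕ => ((1 : ℝ) / 2) ^ k) atTop (𝓝 0) :=
    tendsto_pow_atTop_nhds_zero_of_lt_one (by norm_num) (by norm_num)
  simpa using (this.const_mul (2 * M)).const_add (2 * D)

theorem SobolevBound.eq_zero {c : ℤ → ℂ} (hc : SobolevBound 0 0 c) (n : ℤ) : c n = 0 := by
  simpa using hc.norm_le n

/-- Compactness bounds both solutions in `L²`, which fixes one step length `h`; stability with `D =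
0` then propagates equality from each step to the next. -/
theorem interaction_unique (hA : IsAdmissible ρ γ C H t₀ t₁ w)
    (ha : IsInteractionSolution w t₀ t₁ a) (hb : IsInteractionSolution w t₀ t₁ b)
    (h0 : a t₀ = b t₀) : ∀ t ∈ Icc t₀ t₁, a t = b t := by
  obtain ⟨A, hA0, hA'⟩ := (IsPath.cont ha).exists_bound isCompact_Icc
  obtain ⟨B, hB0, hB'⟩ := (IsPath.cont hb).exists_bound isCompact_Icc
  set M := max A B
  obtain ⟨h, hh, -, hsmall⟩ := exists_small_duhamelConst hA.γ_pos C H 0 (8 * M) one_pos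
  have key : ∀ k : ℕ, ∀ t ∈ Icc t₀ t₁, t ≤ t₀ + k * h → a t = b t := by
    intro k
    induction k with
    | zero =>
      intro t ht ht'
      have : t = t₀ := le_antisymm (by simpa using ht') ht.1
      rw [this, h0]
    | succ k ih =>
      intro t ht ht'
      rcases le_total t (t₀ + k * h) with h1 | h1
      · exact ih t ht h1
      have hr : t₀ ≤ t₀ + k * h := by have : 0 ≤ k * h := by positivity
                                      linarith
      have hsub : ∀ x ∈ Icc (t₀ + k * h) t, x ∈ Icc t₀ t₁ :=
        fun x hx => ⟨hr.trans hx.1, hx.2.trans ht.2⟩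
      have heq := ih (t₀ + k * h) (hsub _ (left_mem_Icc.2 h1)) le_rfl
      have := stability (D := 0) (M := M) (hA.restrict hr ht.2) hh
        (by push_cast at ht'; linarith) (ha.restrict hr ht.2) (hb.restrict hr ht.2)
        (fun x hx => (hA' x (hsub x hx)).mono (le_max_left _ _))
        (fun x hx => (hB' x (hsub x hx)).mono (le_max_right _ _)) hsmall
        (by simpa [heq] using SobolevBound.zero 0) t (right_mem_Icc.2 h1)
      rw [mul_zero] at this
      exact funext fun n => sub_eq_zero.1 (this.eq_zero n)
  intro t ht
  obtain ⟨k, hk⟩ := exists_nat_ge ((t - t₀) / h)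
  refine key k t ht ?_
  rw [div_le_iff₀ hh] at hk
  linarith

/-! ### Regularity of the Duhamel term -/

/-- The nonlinear smoothing effect: the increment of `v` is the time integral of the nonlinearity,
to which the normal form estimate applies with gain `σ`. -/
theorem duhamel_sobolevContinuousOn {σ H' A : ℝ} (hA : IsAdmissible ρ γ C H t₀ t₁ w)
    (hH' : IsKernelBound σ ρ H') (hs : 0 ≤ s) {v : ℝ → ℤ → ℂ}
    (hv : IsInteractionSolution w t₀ t₁ v) (hvA : ∀ t ∈ Icc t₀ t₁, SobolevBound s A (v t)) :
    SobolevContinuousOn (s + σ) (Icc t₀ t₁) (fun t n => v t n - v t₀ n) := by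
  rcases (Icc t₀ t₁).eq_empty_or_nonempty with he | hne
  · rw [he]; exact ⟨fun t ht => ht.elim, fun t ht => ht.elim⟩
  have h01 : t₀ ≤ t₁ := nonempty_Icc.1 hne
  have hA0 : 0 ≤ A := (hvA t₀ (left_mem_Icc.2 h01)).1
  -- No smallness is needed, because `v` is already known to be bounded. The extra 1 keeps `h`
  -- positive on a degenerate interval, and `Y` is enlarged to cover the derivative bound.
  set h := t₁ - t₀ + 1 with hh
  have hpos : 0 < h := by linarith
  set Y := A + h * (2 ^ s * (2 * A * A)) with hY
  have hvA0 : ∀ t ∈ Icc t₀ t₁, SobolevBound 0 A (v t) := fun t ht => (hvA t ht).of_le_order hs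
  have hAY : A ≤ Y := le_add_of_nonneg_right (by positivity)
  have hD : ∀ s', 0 ≤ s' → s' ≤ s → (∀ t ∈ Icc t₀ t₁, SobolevBound s' A (v t)) →
      HasPathBound s' h Y t₀ t₁ v (fun t => nonlin (w t) (v t) (v t)) := by
    intro s' hs' hss h'
    refine fun t ht => ⟨(h' t ht).mono hAY, ?_⟩
    refine (nonlin_derivBound (w t) hs' (h' t ht) (hvA0 t ht) (h' t ht) (hvA0 t ht)).mono ?_
    rw [le_div_iff₀ hpos]
    have : (2 : ℝ) ^ s' ≤ 2 ^ s := Real.rpow_le_rpow_of_exponent_le (by norm_num) hss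
    have h2 : 2 ^ s' * (A * A + A * A) * h ≤ 2 ^ s * (A * A + A * A) * h := by gcongr
    have h3 : 2 ^ s * (A * A + A * A) * h = h * (2 ^ s * (2 * A * A)) := by ring
    linarith
  have p1 := hD s hs le_rfl hvA
  have p0 := hD 0 le_rfl hs hvA0
  have key : ∀ r ∈ Icc t₀ t₁, ∀ t ∈ Icc t₀ t₁, r ≤ t →
      SobolevBound (s + σ) (3 * C * H' * 2 ^ s * (Y * Y + Y * Y) * (t - r) ^ γ)
        (fun n => v t n - v r n) := by
    intro r hr t ht hrt
    refine (hA.osc.normal_form hH' hs hA.C_nonneg hA.γ_pos.le hpos hr.1 hrt ht.2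
      (by linarith [hr.1, ht.2]) hA.cont hv hv p1 p0 p1 p0).of_norm_le fun n => ?_
    rw [IsPath.sub_eq_integral hv hr.1 hrt ht.2]
  refine sobolevContinuousOn_of_holder (E := 3 * C * H' * 2 ^ s * (Y * Y + Y * Y)) hA.γ_pos
    (fun t ht => ⟨_, key t₀ (left_mem_Icc.2 h01) t ht ht.1⟩) fun r hr t ht hrt => ?_
  refine (key r hr t ht hrt).of_norm_le fun n => le_of_eq (by congr 1; ring)

theorem interaction_sobolevContinuousOn {A : ℝ} (hA : IsAdmissible ρ γ C H t₀ t₁ w)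
    (hs : 0 ≤ s) {v : ℝ → ℤ → ℂ}
    (hv : IsInteractionSolution w t₀ t₁ v) (hvA : ∀ t ∈ Icc t₀ t₁, SobolevBound s A (v t)) :
    SobolevContinuousOn s (Icc t₀ t₁) v := by
  rcases (Icc t₀ t₁).eq_empty_or_nonempty with he | hne
  · rw [he]; exact ⟨fun t ht => ht.elim, fun t ht => ht.elim⟩
  have h1 := duhamel_sobolevContinuousOn hA hA.kernel hs hv hvA
  rw [add_zero] at h1
  have h2 := h1.add (.const (hvA t₀ (left_mem_Icc.2 (nonempty_Icc.1 hne))))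
  simpa using h2

end

section

/-! ### Local existence by Picard iteration -/

/-- The Picard iterates of the Duhamel equation with datum `v₀` at time `t₀`. -/
noncomputable def picard (w : ℝ → ℝ) (t₀ : ℝ) (v₀ : ℤ → ℂ) : ℕ → ℝ → ℤ → ℂ
  | 0 => fun _ => v₀
  | k + 1 => fun t n => v₀ n +
      ∫ τ in t₀..t, nonlin (w τ) (picard w t₀ v₀ k τ) (picard w t₀ v₀ k τ) n

/-- The time derivatives of the Picard iterates. -/
noncomputable def picardDeriv (w : ℝ → ℝ) (t₀ : ℝ) (v₀ : ℤ → ℂ) : ℕ → ℝ → ℤ → ℂ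
  | 0 => fun _ _ => 0
  | k + 1 => fun t => nonlin (w t) (picard w t₀ v₀ k t) (picard w t₀ v₀ k t)

variable {ρ γ s C H h t₀ t₁ : ℝ} {w : ℝ → ℝ} {v₀ : ℤ → ℂ} {R Rs : ℝ}

/-- The balls of radius `2R` in `L²` and `2Rs` in `H^s` are preserved: the Duhamel term adds at most
`8κR²` and `8κR·Rs`, with `16κR ≤ 1`. By tameness, smallness involves `R` but not `Rs`. -/
theorem picard_bounds (hA : IsAdmissible ρ γ C H t₀ t₁ w) (hs : 0 ≤ s) (hh : 0 < h)
    (hth : t₁ - t₀ ≤ h) (hz : v₀ 0 = 0) (hR : SobolevBound 0 R v₀) (hRs : SobolevBound s Rs v₀)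
    (hsmall : duhamelConst γ C H s h * (16 * R) ≤ 1) (k : ℕ) :
    IsPath t₀ t₁ (picard w t₀ v₀ k) (picardDeriv w t₀ v₀ k) ∧
      HasPathBound 0 h (2 * R) t₀ t₁ (picard w t₀ v₀ k) (picardDeriv w t₀ v₀ k) ∧
      HasPathBound s h (2 * Rs) t₀ t₁ (picard w t₀ v₀ k) (picardDeriv w t₀ v₀ k) := by
  have hR0 := hR.1
  have hRs0 := hRs.1
  have hκ0 := duhamelConst_mono_order (γ := γ) hA.C_nonneg hA.kernel.1 hh.le hs
  have hconst : ∀ s' R', SobolevBound s' R' v₀ →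
      HasPathBound s' h R' t₀ t₁ (fun _ => v₀) (fun _ _ => 0) :=
    fun s' R' h' _ _ => ⟨h', (DerivBound.zero s').mono (div_nonneg h'.1 hh.le)⟩
  induction k with
  | zero =>
    exact ⟨.const hR hz, (hconst 0 R hR).mono hh (by linarith),
      (hconst s Rs hRs).mono hh (by linarith)⟩
  | succ k ih =>
    obtain ⟨ih1, ih2, ih3⟩ := ih
    -- The summand 0 is the derivative of the constant path `v₀`, so that each iterate is a sum of
    -- two paths.
    have e : ∀ t, picardDeriv w t₀ v₀ (k + 1) t = fun n => 0 +
        nonlin (w t) (picard w t₀ v₀ k t) (picard w t₀ v₀ k t) n := fun t => by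
      funext n; simp [picardDeriv]
    have e' : picardDeriv w t₀ v₀ (k + 1) = fun t n => 0 +
        nonlin (w t) (picard w t₀ v₀ k t) (picard w t₀ v₀ k t) n := funext e
    rw [e']
    refine ⟨(IsPath.const hR hz).add (isPath_duhamel hA hh hth ih1 ih1 ih2 ih2), ?_, ?_⟩
    · refine ((hconst 0 R hR).add
        (hasPathBound_duhamel hA le_rfl hh hth ih1 ih1 ih2 ih2 ih2 ih2)).mono hh ?_
      have h1 := mul_le_mul_of_nonneg_right hsmall hR0
      have h2 := mul_le_mul_of_nonneg_right hκ0 (show 0 ≤ 8 * (R * R) by positivity)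
      nlinarith
    · refine ((hconst s Rs hRs).add
        (hasPathBound_duhamel hA hs hh hth ih1 ih1 ih3 ih2 ih3 ih2)).mono hh ?_
      have h1 := mul_le_mul_of_nonneg_right hsmall hRs0
      nlinarith

/-- Consecutive differences contract by `8κR ≤ 1/2`, starting from `2R + 2R`. -/
theorem picard_sub_bounds (hA : IsAdmissible ρ γ C H t₀ t₁ w) (hs : 0 ≤ s) (hh : 0 < h)
    (hth : t₁ - t₀ ≤ h) (hz : v₀ 0 = 0) (hR : SobolevBound 0 R v₀) (hRs : SobolevBound s Rs v₀)
    (hsmall : duhamelConst γ C H s h * (16 * R) ≤ 1) (k : ℕ) :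
    HasPathBound 0 h (4 * R * (1 / 2) ^ k) t₀ t₁
      (fun t n => picard w t₀ v₀ (k + 1) t n - picard w t₀ v₀ k t n)
      (fun t n => picardDeriv w t₀ v₀ (k + 1) t n - picardDeriv w t₀ v₀ k t n) := by
  have hR0 := hR.1
  have hκ0 := duhamelConst_mono_order (γ := γ) hA.C_nonneg hA.kernel.1 hh.le hs
  have hb := picard_bounds hA hs hh hth hz hR hRs hsmall
  induction k with
  | zero => exact ((hb 1).2.1.sub (hb 0).2.1).mono hh (by norm_num; linarith)
  | succ k ih =>
    have h1 := hasPathBound_duhamel_sub hA hh hth (hb (k + 1)).1 (hb k).1 ih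
      ((hb (k + 1)).2.1.add (hb k).2.1)
    refine (h1.congr (fun t _ n => ?_) fun t _ n => rfl).mono hh ?_
    · simp only [picard]; ring
    · have hq : 0 ≤ R * (1 / 2 : ℝ) ^ k := by positivity
      have e1 := mul_le_mul_of_nonneg_right hsmall hq
      have e2 := mul_le_mul_of_nonneg_right hκ0 (show 0 ≤ 32 * (R * (R * (1 / 2 : ℝ) ^ k)) by
        positivity)
      rw [pow_succ]
      nlinarith

theorem picard_tail_bounds (hA : IsAdmissible ρ γ C H t₀ t₁ w) (hs : 0 ≤ s) (hh : 0 < h)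
    (hth : t₁ - t₀ ≤ h) (hz : v₀ 0 = 0) (hR : SobolevBound 0 R v₀) (hRs : SobolevBound s Rs v₀)
    (hsmall : duhamelConst γ C H s h * (16 * R) ≤ 1) (k j : ℕ) {t : ℝ} (ht : t ∈ Icc t₀ t₁) :
    SobolevBound 0 (8 * R * (1 / 2) ^ k - 8 * R * (1 / 2) ^ (k + j))
      (fun n => picard w t₀ v₀ (k + j) t n - picard w t₀ v₀ k t n) := by
  induction j with
  | zero => simpa using SobolevBound.zero 0
  | succ j ih =>
    have h1 := (picard_sub_bounds hA hs hh hth hz hR hRs hsmall (k + j) t ht).1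
    refine ((h1.add ih).mono (le_of_eq ?_)).of_norm_le fun n => le_of_eq ?_
    · rw [← add_assoc, pow_succ _ (k + j)]; ring
    · rw [← add_assoc]; congr 1; ring

/-- The iterates converge in `L²` only; the uniform `H^s` bound passes to the limit by Fatou. The
admissible length depends on `R` and `s`, not on the `H^s` size. -/
theorem exists_interaction_solution (hle : t₀ ≤ t₁) (hA : IsAdmissible ρ γ C H t₀ t₁ w)
    (hs : 0 ≤ s) (hh : 0 < h) (hth : t₁ - t₀ ≤ h) (hz : v₀ 0 = 0) (hR : SobolevBound 0 R v₀) (hRs : SobolevBound s Rs v₀)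
    (hsmall : duhamelConst γ C H s h * (16 * R) ≤ 1) :
    ∃ v : ℝ → ℤ → ℂ, v t₀ = v₀ ∧ IsInteractionSolution w t₀ t₁ v ∧
      (∀ t ∈ Icc t₀ t₁, SobolevBound 0 (2 * R) (v t)) ∧
      ∀ t ∈ Icc t₀ t₁, SobolevBound s (2 * Rs) (v t) := by
  have hb := picard_bounds hA hs hh hth hz hR hRs hsmall
  have hR0 := hR.1
  set p := picard w t₀ v₀ with hp
  have hlim : ∀ t ∈ Icc t₀ t₁, ∀ n, ∃ z, Tendsto (fun k => p k t n) atTop (𝓝 z) := by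
    intro t ht n
    refine cauchySeq_tendsto_of_complete (cauchySeq_of_le_geometric (1 / 2) (4 * R) (by norm_num)
      fun k => ?_)
    rw [dist_comm, dist_eq_norm]
    exact (picard_sub_bounds hA hs hh hth hz hR hRs hsmall k t ht).1.norm_le n
  choose! v hv using hlim
  have htail : ∀ t ∈ Icc t₀ t₁, ∀ k, SobolevBound 0 (8 * R * (1 / 2) ^ k)
      (fun n => v t n - p k t n) := by
    intro t ht k
    refine SobolevBound.of_tendsto (l := atTop) (c := fun j n => p (k + j) t n - p k t n)
      (Eventually.of_forall fun j =>
        (picard_tail_bounds hA hs hh hth hz hR hRs hsmall k j ht).mono ?_) fun n => ?_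
    · have : 0 ≤ 8 * R * (1 / 2) ^ (k + j) := by positivity
      linarith
    · refine Tendsto.sub_const ?_ _
      simp_rw [add_comm k]
      exact (tendsto_add_atTop_iff_nat k).2 (hv t ht n)
  have hv0 : ∀ t ∈ Icc t₀ t₁, SobolevBound 0 (2 * R) (v t) := fun t ht =>
    .of_tendsto (Eventually.of_forall fun k => ((hb k).2.1 t ht).1) (hv t ht)
  have hvs : ∀ t ∈ Icc t₀ t₁, SobolevBound s (2 * Rs) (v t) := fun t ht =>
    .of_tendsto (Eventually.of_forall fun k => ((hb k).2.2 t ht).1) (hv t ht)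
  have hgeo : Tendsto (fun k : ℕ => 8 * R * (1 / 2 : ℝ) ^ k) atTop (𝓝 0) := by
    simpa using (tendsto_pow_atTop_nhds_zero_of_lt_one (by norm_num : (0 : ℝ) ≤ 1 / 2)
      (by norm_num)).const_mul (8 * R)
  have hcont : SobolevContinuousOn 0 (Icc t₀ t₁) v := by
    refine ⟨fun t ht => ⟨_, hv0 t ht⟩, fun t ht ε hε => ?_⟩
    obtain ⟨k, hk⟩ := (hgeo.eventually (gt_mem_nhds (show 0 < ε / 3 by positivity))).exists
    filter_upwards [(hb k).1.cont.2 t ht (ε / 3) (by positivity), self_mem_nhdsWithin] with r hr hrJ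
    refine ((((htail r hrJ k).mono hk.le).add (hr.sub ((htail t ht k).mono hk.le))).mono
      (by linarith)).of_norm_le fun n => le_of_eq (by congr 1; ring)
  have hconv : ∀ t ∈ Icc t₀ t₁, ∀ n, Tendsto (fun k => nonlin (w t) (p k t) (p k t) n) atTop
      (𝓝 (nonlin (w t) (v t) (v t) n)) := by
    intro t ht n
    rw [tendsto_iff_norm_sub_tendsto_zero]
    have hz : Tendsto (fun k : ℕ => |(n : ℝ)| * (2 * ((8 * R * (1 / 2 : ℝ) ^ k) * (2 * R + 2 * R))))
        atTop (𝓝 0) := by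
      have := ((hgeo.mul_const (2 * R + 2 * R)).const_mul 2).const_mul |(n : ℝ)|
      simpa only [zero_mul, mul_zero] using this
    refine squeeze_zero (fun k => norm_nonneg _) (fun k => ?_) hz
    rw [norm_sub_rev, nonlin_self_sub_self (w t) (hv0 t ht) ((hb k).2.1 t ht).1]
    exact norm_nonlin_le _ (htail t ht k) ((hv0 t ht).add ((hb k).2.1 t ht).1) n
  have heq : ∀ t ∈ Icc t₀ t₁, ∀ n, v t n = v₀ n +
      ∫ τ in t₀..t, nonlin (w τ) (v τ) (v τ) n := by
    intro t ht n
    -- The shifted iterates have the same limit, and by dominated convergence their Duhamel formula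
    -- passes to it.
    refine tendsto_nhds_unique ((tendsto_add_atTop_iff_nat 1).2 (hv t ht n)) ?_
    refine Tendsto.const_add (v₀ n)
      (f := fun k => ∫ τ in t₀..t, nonlin (w τ) (p k τ) (p k τ) n) ?_
    refine intervalIntegral.tendsto_integral_filter_of_dominated_convergence
      (fun _ => |(n : ℝ)| * (2 * ((2 * R) * (2 * R)))) ?_ ?_ (by simp) ?_
    · refine Eventually.of_forall fun k => ?_
      rw [uIoc_of_le ht.1]
      exact (((hb k).1.cont.continuousOn_nonlin (hb k).1.cont hA.cont n).mono
        (Ioc_subset_Icc_self.trans (Icc_subset_Icc_right ht.2))).aestronglyMeasurable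
        measurableSet_Ioc
    · refine Eventually.of_forall fun k => Eventually.of_forall fun τ hτ => ?_
      rw [uIoc_of_le ht.1] at hτ
      have hτ' : τ ∈ Icc t₀ t₁ := ⟨hτ.1.le, hτ.2.trans ht.2⟩
      exact norm_nonlin_le _ ((hb k).2.1 τ hτ').1 ((hb k).2.1 τ hτ').1 n
    · refine Eventually.of_forall fun τ hτ => ?_
      rw [uIoc_of_le ht.1] at hτ
      exact hconv τ ⟨hτ.1.le, hτ.2.trans ht.2⟩ n
  have hinit : v t₀ = v₀ := funext fun n => by simpa using heq t₀ (left_mem_Icc.2 hle) n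
  refine ⟨v, hinit, ⟨fun t ht => ?_, hcont, fun n => hcont.continuousOn_nonlin hcont hA.cont n,
    fun t ht n => ?_⟩, hv0, hvs⟩
  · rw [heq t ht 0, hz]; simp [nonlin]
  · rw [hinit]; exact heq t ht n

/-! ### Real solutions and conservation of the `L²` norm -/

/-- The symmetry `a_{-n} = conj a_n` of the Fourier coefficients of a real function. -/
def IsConjSymm (a : ℤ → ℂ) : Prop := ∀ n, a (-n) = (starRingEnd ℂ) (a n)

theorem resonance_neg (n m : ℤ) : resonance (-n) (-m) = -resonance n m := by
  unfold resonance
  rw [abs_neg, abs_neg, show -n - -m = -(n - m) by ring, abs_neg]; ring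

theorem conj_phase (θ : ℝ) (k : ℤ) : (starRingEnd ℂ) (phase θ k) = phase θ (-k) := by
  unfold phase
  rw [← Complex.exp_conj]
  simp

/-- The sequence of Fourier coefficients of the complex conjugate. -/
def conjReflect (a : ℤ → ℂ) : ℤ → ℂ := fun n => (starRingEnd ℂ) (a (-n))

/-- The resonance function is odd under `(n, m) ↦ (-n, -m)`, which compensates the conjugation of
the phases; hence conjugates of solutions are solutions. -/
theorem nonlin_conjReflect (θ : ℝ) (a b : ℤ → ℂ) :
    nonlin θ (conjReflect a) (conjReflect b) = conjReflect (nonlin θ a b) := by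
  funext n
  unfold conjReflect nonlin
  rw [map_mul, Complex.conj_tsum, ← (Equiv.neg ℤ).tsum_eq]
  congr 1
  · simp
  · refine tsum_congr fun m => ?_
    rw [map_mul, map_mul, conj_phase, ← resonance_neg, neg_neg]
    simp only [Equiv.neg_apply, neg_neg]
    rw [show -(n - -m) = -n - m by ring]

theorem SobolevBound.conjReflect {M : ℝ} {a : ℤ → ℂ} (ha : SobolevBound s M a) :
    SobolevBound s M (conjReflect a) := by
  refine ⟨ha.1, fun S => ?_⟩
  have := ha.2 (S.image fun n => -n)
  rw [Finset.sum_image (fun x _ y _ h => by simpa using h)] at this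
  simpa [ModulatedBO.conjReflect] using this

theorem IsInteractionSolution.conjReflect {v : ℝ → ℤ → ℂ} (hv : IsInteractionSolution w t₀ t₁ v) :
    IsInteractionSolution w t₀ t₁ (fun t => ModulatedBO.conjReflect (v t)) := by
  have hp : IsPath t₀ t₁ (fun t => ModulatedBO.conjReflect (v t))
      (fun t => ModulatedBO.conjReflect (nonlin (w t) (v t) (v t))) := by
    refine ⟨fun t ht => ?_, ⟨fun t ht => ?_, fun t ht ε hε => ?_⟩, fun n => ?_, fun t ht n => ?_⟩
    · simp [ModulatedBO.conjReflect, IsPath.zero hv t ht]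
    · exact ((IsPath.cont hv).1 t ht).imp fun M hM => hM.conjReflect
    · filter_upwards [(IsPath.cont hv).2 t ht ε hε] with r hr
      exact hr.conjReflect.of_norm_le fun n => by simp [ModulatedBO.conjReflect]
    · exact Complex.continuous_conj.comp_continuousOn (IsPath.contDeriv hv (-n))
    · simp only [ModulatedBO.conjReflect]
      rw [IsPath.eq hv t ht (-n), map_add, intervalIntegral.integral_of_le ht.1,
        intervalIntegral.integral_of_le ht.1, integral_conj]
  simpa only [IsInteractionSolution, nonlin_conjReflect] using hp

theorem IsInteractionSolution.isConjSymm {v : ℝ → ℤ → ℂ} (hA : IsAdmissible ρ γ C H t₀ t₁ w)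
    (hv : IsInteractionSolution w t₀ t₁ v) (h0 : IsConjSymm (v t₀)) :
    ∀ t ∈ Icc t₀ t₁, IsConjSymm (v t) := by
  intro t ht n
  have h := congrFun (interaction_unique hA hv hv.conjReflect
    (funext fun n => by rw [ModulatedBO.conjReflect, h0 n, Complex.conj_conj]) t ht) (-n)
  simpa [ModulatedBO.conjReflect] using h

end

/-! ### Cancellation of the cubic form and the `L²` bound -/

section

variable {ρ γ C H h t₀ t₁ : ℝ} {w : ℝ → ℝ}

theorem phase_add (θ : ℝ) (j k : ℤ) : phase θ (j + k) = phase θ j * phase θ k := by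
  unfold phase
  rw [← Complex.exp_add]
  congr 1
  push_cast; ring

theorem summable_bracket_rpow {b : ℝ} (hb : 1 < b) : Summable fun n : ℤ => bracket n ^ (-b) := by
  have h1 : Summable fun n : ℤ => |(n : ℝ)| ^ (-b) := Real.summable_abs_int_rpow hb
  have h2 : Summable fun n : ℤ => if n = 0 then (1 : ℝ) else 0 :=
    (hasSum_ite_eq (0 : ℤ) (1 : ℝ)).summable
  refine Summable.of_nonneg_of_le (fun n => (bracket_rpow_pos n _).le) (fun n => ?_) (h1.add h2)
  by_cases hn : n = 0
  · subst hn
    have : bracket ((0 : ℤ) : ℝ) = 1 := by simp [bracket]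
    rw [this, Real.one_rpow]
    simp only [if_true]
    linarith [Real.rpow_nonneg (abs_nonneg ((0 : ℤ) : ℝ)) (-b)]
  · rw [if_neg hn, add_zero]
    exact Real.rpow_le_rpow_of_nonpos (by positivity) (abs_le_bracket _) (by linarith)

theorem SobolevBound.norm_le_rpow {s A : ℝ} {a : ℤ → ℂ} (ha : SobolevBound s A a) (n : ℤ) :
    ‖a n‖ ≤ A * bracket n ^ (-s) := by
  have h1 := ha.le n
  have h2 := bracket_rpow_pos n s
  rw [Real.rpow_neg (bracket_pos _).le, ← div_eq_mul_inv, le_div_iff₀ h2]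
  linarith

theorem abs_mul_norm_le {A : ℝ} {a : ℤ → ℂ} (ha : SobolevBound 3 A a) (n : ℤ) :
    |(n : ℝ)| * ‖a n‖ ≤ A * bracket n ^ (-2 : ℝ) := by
  have h1 := ha.norm_le_rpow n
  have h2 : bracket n * bracket n ^ (-3 : ℝ) = bracket n ^ (-2 : ℝ) := by
    nth_rewrite 1 [← Real.rpow_one (bracket (n : ℝ))]
    rw [← Real.rpow_add (bracket_pos _)]
    norm_num
  have h3 := ha.1
  have h4 := bracket_pos (n : ℝ)
  calc |(n : ℝ)| * ‖a n‖ ≤ bracket n * (A * bracket n ^ (-3 : ℝ)) := by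
        gcongr
        exact abs_le_bracket _
    _ = _ := by rw [mul_left_comm, h2]

/-- The cyclic permutation `(n, m) ↦ (-m, n - m)` of the frequencies of a resonant triple. -/
def cyclicEquiv : ℤ × ℤ ≃ ℤ × ℤ where
  toFun p := (-p.2, p.1 - p.2)
  invFun p := (p.2 - p.1, -p.1)
  left_inv p := by ext <;> simp
  right_inv p := by ext <;> simp

/-- `∫ u ∂ₓ(u²) = 0` in terms of the Fourier coefficients. -/
theorem hasSum_cubic_eq_zero {A : ℝ} {u : ℤ → ℂ} (hu : SobolevBound 3 A u) :
    Summable (fun p : ℤ × ℤ => (p.1 : ℂ) * (u (-p.1) * u p.2 * u (p.1 - p.2))) ∧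
      ∑' p : ℤ × ℤ, (p.1 : ℂ) * (u (-p.1) * u p.2 * u (p.1 - p.2)) = 0 := by
  set f : ℤ × ℤ → ℂ := fun p => (p.1 : ℂ) * (u (-p.1) * u p.2 * u (p.1 - p.2)) with hf
  have hA := hu.1
  have hsum : Summable f := by
    have h2 : Summable fun n : ℤ => A * bracket n ^ (-2 : ℝ) :=
      (summable_bracket_rpow (by norm_num)).mul_left _
    have h3 : Summable fun n : ℤ => A * bracket n ^ (-3 : ℝ) :=
      (summable_bracket_rpow (by norm_num)).mul_left _
    have h4 := (h2.mul_of_nonneg h3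
      (fun n => mul_nonneg hA (bracket_rpow_pos n _).le)
      (fun n => mul_nonneg hA (bracket_rpow_pos n _).le)).mul_right A
    refine Summable.of_norm_bounded h4 fun p => ?_
    have e1 := abs_mul_norm_le hu (-p.1)
    simp only [Int.cast_neg, abs_neg, bracket_neg] at e1
    have e2 := hu.norm_le_rpow p.2
    have e3 := (hu.of_le_order (show (0 : ℝ) ≤ 3 by norm_num)).norm_le (p.1 - p.2)
    have e4 := bracket_rpow_pos p.1 (-2)
    have e5 := bracket_rpow_pos p.2 (-3)
    rw [hf]
    simp only [norm_mul, Complex.norm_intCast]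
    calc _ = (|(p.1 : ℝ)| * ‖u (-p.1)‖) * ‖u p.2‖ * ‖u (p.1 - p.2)‖ := by ring
      _ ≤ _ := by gcongr
  refine ⟨hsum, ?_⟩
  have h1 := cyclicEquiv.tsum_eq f
  have h2 := shearEquiv.tsum_eq (fun p => f (cyclicEquiv p))
  have s1 : Summable fun p => f (cyclicEquiv p) := cyclicEquiv.summable_iff.2 hsum
  have s2 : Summable fun p => f (cyclicEquiv (shearEquiv p)) := shearEquiv.summable_iff.2 s1
  -- The triple `(-n, m, n-m)` sums to zero. The three rearrangements share the product of
  -- coefficients and carry the weights `n`, `-m`, `-(n-m)`, which cancel.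
  have hz : ∀ p, f p + f (cyclicEquiv p) + f (cyclicEquiv (shearEquiv p)) = 0 := by
    rintro ⟨n, m⟩
    simp only [hf, cyclicEquiv, shearEquiv, Equiv.coe_fn_mk]
    rw [show -m - (n - m) = -n by ring, show n - (n - m) = m by ring,
      show -(n - m) - m = -n by ring, neg_neg, neg_neg]
    push_cast; ring
  have h3 : ∑' p, (f p + f (cyclicEquiv p) + f (cyclicEquiv (shearEquiv p))) = 0 := by
    simp [hz]
  rw [(hsum.add s1).tsum_add s2, hsum.tsum_add s1, h2, h1] at h3
  have h4 : (3 : ℂ) * ∑' p, f p = 0 := by linear_combination h3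
  simpa using h4

/-- Conjugation symmetry turns the conjugate of `v n` into `v (-n)`. The resonance phase then splits
over the three factors, so the sum is the cubic form of the physical-side coefficients `u`. -/
theorem hasSum_conj_mul_nonlin {A θ : ℝ} {v : ℤ → ℂ} (hv : SobolevBound 3 A v)
    (hsymm : IsConjSymm v) :
    HasSum (fun n => (starRingEnd ℂ) (v n) * nonlin θ v v n) 0 := by
  set u : ℤ → ℂ := fun n => phase θ (|n| * n) * v n with hu
  have hus : SobolevBound 3 A u := hv.of_norm_le fun n => by simp [hu, norm_phase]
  obtain ⟨hsum, hzero⟩ := hasSum_cubic_eq_zero hus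
  have h1 := hsum.hasSum
  rw [hzero] at h1
  have h2 := (h1.prod_fiberwise fun n => (hsum.prod_factor n).hasSum).mul_left Complex.I
  rw [mul_zero] at h2
  suffices h : (fun n => (starRingEnd ℂ) (v n) * nonlin θ v v n) = fun n : ℤ =>
      Complex.I * ∑' m : ℤ, (n : ℂ) * (u (-n) * u m * u (n - m)) by
    rw [h]; exact h2
  funext n
  unfold nonlin
  rw [tsum_mul_left, show (starRingEnd ℂ) (v n) * (Complex.I * n * ∑' m, phase θ (resonance n m) *
    (v m * v (n - m))) = Complex.I * (n * ((starRingEnd ℂ) (v n) *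
      ∑' m, phase θ (resonance n m) * (v m * v (n - m)))) by ring, ← tsum_mul_left]
  congr 2
  refine tsum_congr fun m => ?_
  simp only [hu]
  have e : resonance n m = |-n| * -n + |m| * m + |n - m| * (n - m) := by
    unfold resonance; rw [abs_neg]; ring
  rw [e, phase_add, phase_add, hsymm n]
  ring

/-- Each `‖v_n‖²` is differentiated separately. Order 3 makes the derivatives summable with a
uniform majorant, so sum and time integral may be exchanged and the cubic cancellation applies. -/
theorem norm_sq_conserved {A : ℝ} {v : ℝ → ℤ → ℂ} (hv : IsInteractionSolution w t₀ t₁ v)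
    (hA : ∀ t ∈ Icc t₀ t₁, SobolevBound 3 A (v t)) (hsymm : ∀ t ∈ Icc t₀ t₁, IsConjSymm (v t))
    {t : ℝ} (ht : t ∈ Icc t₀ t₁) : ∑' n, ‖v t n‖ ^ 2 = ∑' n, ‖v t₀ n‖ ^ 2 := by
  have ht₀ : t₀ ∈ Icc t₀ t₁ := left_mem_Icc.2 (ht.1.trans ht.2)
  have hA0 : 0 ≤ A := (hA t ht).1
  have hsub : Icc t₀ t ⊆ Icc t₀ t₁ := Icc_subset_Icc_right ht.2
  set g : ℤ → ℝ → ℝ := fun n τ => 2 * ((starRingEnd ℂ) (v τ n) *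
    nonlin (w τ) (v τ) (v τ) n).re with hg
  have hcv : ∀ n, ContinuousOn (fun τ => v τ n) (Icc t₀ t) := fun n =>
    ((IsPath.cont hv).continuousOn_coeff n).mono hsub
  have hcg : ∀ n, ContinuousOn (g n) (Icc t₀ t) := fun n =>
    continuousOn_const.mul (Complex.continuous_re.comp_continuousOn
      ((Complex.continuous_conj.comp_continuousOn (hcv n)).mul
        ((IsPath.contDeriv hv n).mono hsub)))
  have hint : ∀ n, ∫ τ in t₀..t, g n τ = ‖v t n‖ ^ 2 - ‖v t₀ n‖ ^ 2 := by
    intro n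
    refine intervalIntegral.integral_eq_sub_of_hasDerivAt_of_le ht.1 (f := fun τ => ‖v τ n‖ ^ 2)
      ((hcv n).norm.pow 2) (fun x hx => ?_) ((hcg n).intervalIntegrable_of_Icc ht.1)
    have := (IsPath.hasDerivAt hv n ⟨hx.1, hx.2.trans_le ht.2⟩).norm_sq
    rwa [Complex.inner, mul_comm (nonlin _ _ _ _)] at this
  have hbound : ∀ n, ∀ τ ∈ Icc t₀ t, ‖g n τ‖ ≤ A * bracket n ^ (-2 : ℝ) * (4 * (A * A)) := by
    intro n τ hτ
    have hτA := hA τ (hsub hτ)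
    have h0 := hτA.of_le_order (show (0 : ℝ) ≤ 3 by norm_num)
    rw [hg, Real.norm_eq_abs, abs_mul, abs_two]
    have e1 := Complex.abs_re_le_norm ((starRingEnd ℂ) (v τ n) * nonlin (w τ) (v τ) (v τ) n)
    rw [norm_mul, Complex.norm_conj] at e1
    have e2 := norm_nonlin_le (w τ) h0 h0 n
    have e3 := abs_mul_norm_le hτA n
    have e4 := mul_le_mul_of_nonneg_left e2 (norm_nonneg (v τ n))
    have e5 := mul_le_mul_of_nonneg_right e3 (show 0 ≤ 4 * (A * A) by positivity)
    linarith
  have hsum0 : HasSum (fun n => ∫ τ in t₀..t, g n τ) (∫ τ in t₀..t, (0 : ℝ)) := by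
    refine intervalIntegral.hasSum_integral_of_dominated_convergence
      (fun n _ => A * bracket n ^ (-2 : ℝ) * (4 * (A * A))) (fun n => ?_) (fun n => ?_)
      ?_ (by simp) ?_
    · rw [uIoc_of_le ht.1]
      exact ((hcg n).mono Ioc_subset_Icc_self).aestronglyMeasurable measurableSet_Ioc
    · refine Eventually.of_forall fun τ hτ => ?_
      rw [uIoc_of_le ht.1] at hτ
      exact hbound n τ (Ioc_subset_Icc_self hτ)
    · exact Eventually.of_forall fun τ _ =>
        ((summable_bracket_rpow (by norm_num)).mul_left A).mul_right _
    · refine Eventually.of_forall fun τ hτ => ?_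
      rw [uIoc_of_le ht.1] at hτ
      have hτ' := hsub (Ioc_subset_Icc_self hτ)
      have := Complex.hasSum_re (hasSum_conj_mul_nonlin (θ := w τ) (hA τ hτ') (hsymm τ hτ'))
      simpa only [Complex.zero_re, mul_zero] using this.mul_left 2
  simp only [hint, intervalIntegral.integral_zero] at hsum0
  have s1 := (hA t ht).summable_sq (by norm_num)
  have s2 := (hA t₀ ht₀).summable_sq (by norm_num)
  have := hsum0.tsum_eq
  rw [s1.tsum_sub s2] at this
  linarith

theorem exists_sobolevBound_of_finite (s : ℝ) (S : Finset ℤ) {c : ℤ → ℂ}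
    (hc : ∀ n, n ∉ S → c n = 0) : ∃ M, SobolevBound s M c := by
  refine ⟨Real.sqrt (∑ n ∈ S, (bracket n ^ s * ‖c n‖) ^ 2), Real.sqrt_nonneg _, fun S' => ?_⟩
  rw [Real.sq_sqrt (Finset.sum_nonneg fun _ _ => sq_nonneg _)]
  calc _ ≤ ∑ n ∈ S' ∪ S, (bracket n ^ s * ‖c n‖) ^ 2 :=
        Finset.sum_le_sum_of_subset_of_nonneg Finset.subset_union_left fun _ _ _ => sq_nonneg _
    _ = _ := (Finset.sum_subset Finset.subset_union_right fun n _ hn => by simp [hc n hn]).symm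

/-- The `L²` norm of real solutions does not increase. -/
theorem sobolevBound_zero_preserved {R : ℝ} {v : ℝ → ℤ → ℂ} (hle : t₀ ≤ t₁)
    (hA : IsAdmissible ρ γ C H t₀ t₁ w) (hh : 0 < h) (hth : t₁ - t₀ ≤ h)
    (hsmall : duhamelConst γ C H 3 h * (16 * R) ≤ 1)
    (hv : IsInteractionSolution w t₀ t₁ v) (hsymm : IsConjSymm (v t₀))
    (hR : SobolevBound 0 R (v t₀)) (hv2 : ∀ t ∈ Icc t₀ t₁, SobolevBound 0 (2 * R) (v t)) :
    ∀ t ∈ Icc t₀ t₁, SobolevBound 0 R (v t) := by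
  have hR0 := hR.1
  have hκ0 := duhamelConst_mono_order (γ := γ) hA.C_nonneg hA.kernel.1 hh.le
    (show (0 : ℝ) ≤ 3 by norm_num)
  have hsmall0 : duhamelConst γ C H 0 h * (8 * (2 * R)) ≤ 1 := by nlinarith
  have key : ∀ ε > 0, ∀ t ∈ Icc t₀ t₁, SobolevBound 0 (R + 2 * ε) (v t) := by
    intro ε hε t ht
    obtain ⟨S, hS⟩ := hR.exists_finset_tail hε
    -- The frequency set is made symmetric so that the truncated datum is still real.
    set S' := S ∪ S.image (fun n => -n) with hS'
    have hS'neg : ∀ n, -n ∈ S' ↔ n ∈ S' := by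
      intro n
      simp only [hS', Finset.mem_union, Finset.mem_image, neg_inj, exists_eq_right]
      constructor
      · rintro (h | h)
        · exact Or.inr ⟨-n, h, neg_neg n⟩
        · exact Or.inl h
      · rintro (h | ⟨m, hm, rfl⟩)
        · exact Or.inr h
        · exact Or.inl (by simpa using hm)
    set c : ℤ → ℂ := fun n => if n ∈ S' then v t₀ n else 0 with hc
    have hcR : SobolevBound 0 R c := hR.of_norm_le fun n => by
      simp only [hc]; split_ifs <;> simp
    obtain ⟨R₃, hR₃⟩ := exists_sobolevBound_of_finite 3 S' (c := c)
      fun n hn => by simp [hc, hn]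
    have hc0 : c 0 = 0 := by
      simp [hc, IsPath.zero hv t₀ (left_mem_Icc.2 hle)]
    -- The smooth approximant lives on the whole interval: smallness at order 3 involves only the
    -- `L²` radius, not the possibly huge `R₃`.
    obtain ⟨u, hu0, hu, hu2, hu3⟩ := exists_interaction_solution hle hA (by norm_num) hh hth hc0
      hcR hR₃ hsmall
    have hus : IsConjSymm (u t₀) := by
      rw [hu0]
      intro n
      simp only [hc, hS'neg]
      split_ifs
      · exact hsymm n
      · simp
    have hcons := norm_sq_conserved hu hu3 (hu.isConjSymm hA hus) ht
    have huR : SobolevBound 0 R (u t) := by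
      refine ⟨hR0, fun S => ?_⟩
      simp only [Real.rpow_zero, one_mul]
      refine (((hu2 t ht).summable_sq le_rfl).sum_le_tsum S fun _ _ => sq_nonneg _).trans ?_
      rw [hcons, hu0]
      exact Real.tsum_le_of_sum_le (fun _ => sq_nonneg _) fun S => by simpa using hcR.2 S
    have hD : SobolevBound 0 ε (fun n => v t₀ n - u t₀ n) := by
      rw [hu0]
      refine hS.of_norm_le fun n => ?_
      simp only [hc]
      by_cases h1 : n ∈ S'
      · simp [h1]
      · have h2 : n ∉ S := fun h => h1 (Finset.mem_union_left _ h)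
        simp [h1, h2]
    have hst := stability hA hh hth hv hu hv2 hu2 hsmall0 hD t ht
    exact (huR.add hst).of_norm_le fun n => le_of_eq (by congr 1; ring)
  intro t ht
  refine SobolevBound.of_tendsto_bound (l := 𝓝[>] (0 : ℝ)) (m := fun ε => R + 2 * ε)
    (eventually_nhdsWithin_of_forall fun ε hε => key ε hε t ht) ?_
  have hcont : Continuous fun ε : ℝ => R + 2 * ε := by fun_prop
  simpa using (hcont.tendsto 0).mono_left (nhdsWithin_le_nhds (s := Ioi 0))

end

section

/-! ### Gluing and global existence in the interaction representation -/

variable {ρ γ C H h s t₀ t₁ t₂ : ℝ} {w : ℝ → ℝ} {a b : ℝ → ℤ → ℂ}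

/-- Closedness makes the neighbourhood filter within a set trivial at points outside it, so only the
set containing the point matters. -/
theorem SobolevContinuousOn.union {K K' : Set ℝ} (hK : IsClosed K) (hK' : IsClosed K')
    (h : SobolevContinuousOn s K a) (h' : SobolevContinuousOn s K' a) :
    SobolevContinuousOn s (K ∪ K') a := by
  have aux : ∀ {L : Set ℝ}, IsClosed L → SobolevContinuousOn s L a → ∀ t, ∀ ε > 0,
      ∀ᶠ r in 𝓝[L] t, SobolevBound s ε (fun n => a r n - a t n) := by
    intro L hL hLa t ε hε
    by_cases ht : t ∈ L
    · exact hLa.2 t ht ε hε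
    · rw [notMem_closure_iff_nhdsWithin_eq_bot.1 (by rwa [hL.closure_eq])]
      exact eventually_bot
  refine ⟨fun t ht => ht.elim (h.1 t) (h'.1 t), fun t _ ε hε => ?_⟩
  rw [nhdsWithin_union, eventually_sup]
  exact ⟨aux hK h t ε hε, aux hK' h' t ε hε⟩

theorem IsInteractionSolution.congr (ha : IsInteractionSolution w t₀ t₁ a)
    (hab : ∀ t ∈ Icc t₀ t₁, b t = a t) : IsInteractionSolution w t₀ t₁ b := by
  refine ⟨fun t ht => by rw [hab t ht]; exact IsPath.zero ha t ht,
    (IsPath.cont ha).congr hab, fun n => ?_, fun t ht n => ?_⟩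
  · exact (IsPath.contDeriv ha n).congr fun t ht => by simp only [hab t ht]
  · rw [hab t ht, hab t₀ (left_mem_Icc.2 (ht.1.trans ht.2)), IsPath.eq ha t ht n]
    congr 1
    refine intervalIntegral.integral_congr fun τ hτ => ?_
    rw [uIcc_of_le ht.1] at hτ
    simp only [hab τ ⟨hτ.1, hτ.2.trans ht.2⟩]

theorem IsInteractionSolution.glue (h01 : t₀ ≤ t₁) (h12 : t₁ ≤ t₂)
    (hw : ContinuousOn w (Icc t₀ t₂)) {c : ℝ → ℤ → ℂ} (hc : IsInteractionSolution w t₀ t₁ c)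
    (hc' : IsInteractionSolution w t₁ t₂ c) : IsInteractionSolution w t₀ t₂ c := by
  have hU : Icc t₀ t₂ = Icc t₀ t₁ ∪ Icc t₁ t₂ := (Icc_union_Icc_eq_Icc h01 h12).symm
  have hcont : SobolevContinuousOn 0 (Icc t₀ t₂) c := by
    rw [hU]; exact (IsPath.cont hc).union isClosed_Icc isClosed_Icc (IsPath.cont hc')
  have hN : ∀ n, ContinuousOn (fun t => nonlin (w t) (c t) (c t) n) (Icc t₀ t₂) :=
    fun n => hcont.continuousOn_nonlin hcont hw n
  refine ⟨fun t ht => ?_, hcont, hN, fun t ht n => ?_⟩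
  · rw [hU] at ht
    exact ht.elim (IsPath.zero hc t) (IsPath.zero hc' t)
  · rcases le_total t t₁ with h | h
    · exact IsPath.eq hc t ⟨ht.1, h⟩ n
    · rw [IsPath.eq hc' t ⟨h, ht.2⟩ n, IsPath.eq hc t₁ (right_mem_Icc.2 h01) n, add_assoc,
        intervalIntegral.integral_add_adjacent_intervals]
      · exact ((hN n).mono (Icc_subset_Icc_right h12)).intervalIntegrable_of_Icc h01
      · exact ((hN n).mono (Icc_subset_Icc h01 ht.2)).intervalIntegrable_of_Icc h

/-- The `L²` bound `R` is the same at the start of every step, so a single step length works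
throughout `[0,T]`. The `H^s` bound may double at each step, but there are finitely many. -/
theorem exists_real_interaction_solution {T R Rs : ℝ} (hT : 0 < T)
    (hA : IsAdmissible ρ γ C H 0 T w) (hs : 0 ≤ s) {v₀ : ℤ → ℂ} (hz : v₀ 0 = 0)
    (hsymm : IsConjSymm v₀) (hR : SobolevBound 0 R v₀) (hRs : SobolevBound s Rs v₀) :
    ∃ v : ℝ → ℤ → ℂ, v 0 = v₀ ∧ IsInteractionSolution w 0 T v ∧
      ∃ A, ∀ t ∈ Icc 0 T, SobolevBound s A (v t) := by
  -- Order `s` serves the solution itself, order 3 the smooth approximants behind the `L²` bound.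
  obtain ⟨h, hh, hhT, hsmall⟩ :=
    exists_small_duhamelConst hA.γ_pos C H (max s 3) (16 * R) hT
  have hR0 := hR.1
  have hsmall_s : duhamelConst γ C H s h * (16 * R) ≤ 1 :=
    (mul_le_mul_of_nonneg_right (duhamelConst_mono_order hA.C_nonneg hA.kernel.1 hh.le
      (le_max_left s 3)) (by positivity)).trans hsmall
  have hsmall_3 : duhamelConst γ C H 3 h * (16 * R) ≤ 1 :=
    (mul_le_mul_of_nonneg_right (duhamelConst_mono_order hA.C_nonneg hA.kernel.1 hh.le
      (le_max_right s 3)) (by positivity)).trans hsmall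
  have key : ∀ k : ℕ, ∃ v : ℝ → ℤ → ℂ, ∃ A, v 0 = v₀ ∧
      IsInteractionSolution w 0 (min (k * h) T) v ∧
      ∀ t ∈ Icc 0 (min (k * h) T), SobolevBound s A (v t) ∧ SobolevBound 0 R (v t) := by
    intro k
    induction k with
    | zero =>
      have hp : IsPath 0 (min ((0 : ℕ) * h) T) (fun _ => v₀)
          (fun t => nonlin (w t) v₀ v₀) := by
        have h0 : min ((0 : ℕ) * h) T = 0 := by simp [hT.le]
        rw [h0]
        refine ⟨fun _ _ => hz, .const hR, fun n => ?_, fun t ht n => ?_⟩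
        · rw [Icc_self]; exact continuousOn_singleton _ _
        · rw [Icc_self, mem_singleton_iff] at ht
          simp [ht]
      exact ⟨fun _ => v₀, Rs, rfl, hp, fun t _ => ⟨hRs, hR⟩⟩
    | succ k ih =>
      obtain ⟨v, A, hv0, hv, hvb⟩ := ih
      set T₁ := min (k * h) T with hT₁
      set T₂ := min ((k + 1 : ℕ) * h) T with hT₂
      have h1 : 0 ≤ T₁ := le_min (by positivity) hT.le
      have h12 : T₁ ≤ T₂ := min_le_min_right _ (by push_cast; nlinarith)
      have h2T : T₂ ≤ T := min_le_right _ _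
      have hlen : T₂ - T₁ ≤ h := by
        rw [sub_le_iff_le_add, hT₁, ← min_add_add_left, hT₂]
        refine min_le_min ?_ (by linarith)
        push_cast; linarith
      have hA' := hA.restrict h1 h2T
      have hmem : T₁ ∈ Icc 0 T₁ := right_mem_Icc.2 h1
      obtain ⟨u, hu0, hu, hu2, hus⟩ := exists_interaction_solution h12 hA' hs hh hlen
        (IsPath.zero hv T₁ hmem) (hvb T₁ hmem).2 (hvb T₁ hmem).1 hsmall_s
      have hsv : IsConjSymm (v T₁) := hv.isConjSymm (hA.restrict le_rfl (h12.trans h2T))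
        (by rwa [hv0]) T₁ hmem
      have huR := sobolevBound_zero_preserved h12 hA' hh hlen hsmall_3 hu (by rwa [hu0])
        (by rw [hu0]; exact (hvb T₁ hmem).2) hu2
      set c : ℝ → ℤ → ℂ := fun t => if t ≤ T₁ then v t else u t with hc
      have c1 : ∀ t ∈ Icc 0 T₁, c t = v t := fun t ht => if_pos ht.2
      have c2 : ∀ t ∈ Icc T₁ T₂, c t = u t := by
        intro t ht
        by_cases h : t ≤ T₁
        · rw [le_antisymm h ht.1, c1 _ hmem, hu0]
        · exact if_neg h
      refine ⟨c, max A (2 * A), by rw [c1 0 ⟨le_rfl, h1⟩, hv0],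
        (hv.congr c1).glue h1 h12 (hA.cont.mono (Icc_subset_Icc_right h2T)) (hu.congr c2),
        fun t ht => ?_⟩
      rcases le_total t T₁ with h | h
      · rw [c1 t ⟨ht.1, h⟩]
        exact ⟨(hvb t ⟨ht.1, h⟩).1.mono (le_max_left _ _), (hvb t ⟨ht.1, h⟩).2⟩
      · rw [c2 t ⟨h, ht.2⟩]
        exact ⟨(hus t ⟨h, ht.2⟩).mono (le_max_right _ _), huR t ⟨h, ht.2⟩⟩
  obtain ⟨k, hk⟩ := exists_nat_ge (T / h)
  rw [div_le_iff₀ hh] at hk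
  obtain ⟨v, A, hv0, hv, hvb⟩ := key k
  rw [min_eq_right hk] at hv hvb
  exact ⟨v, hv0, hv, A, fun t ht => (hvb t ht).1⟩

/-- A family of solutions on all bounded intervals gives a solution for all times. -/
theorem exists_global_interaction_solution (hs : 0 ≤ s)
    (hA : ∀ T : ℝ, 0 < T → ∃ C H, IsAdmissible ρ γ C H 0 T w) {v₀ : ℤ → ℂ} {Rs : ℝ}
    (hz : v₀ 0 = 0) (hsymm : IsConjSymm v₀) (hRs : SobolevBound s Rs v₀) :
    ∃ v : ℝ → ℤ → ℂ, v 0 = v₀ ∧ ∀ T : ℝ, 0 < T → IsInteractionSolution w 0 T v ∧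
      SobolevContinuousOn s (Icc 0 T) v := by
  have hex : ∀ k : ℕ, ∃ v : ℝ → ℤ → ℂ, v 0 = v₀ ∧ IsInteractionSolution w 0 (k + 1) v ∧
      SobolevContinuousOn s (Icc 0 (k + 1 : ℝ)) v := by
    intro k
    have hk : (0 : ℝ) < k + 1 := by positivity
    obtain ⟨C, H, hCH⟩ := hA _ hk
    obtain ⟨v, hv0, hv, A, hvA⟩ :=
      exists_real_interaction_solution hk hCH hs hz hsymm (hRs.of_le_order hs) hRs
    exact ⟨v, hv0, hv, interaction_sobolevContinuousOn hCH hs hv hvA⟩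
  choose V hV0 hV hVc using hex
  have hagree : ∀ k l : ℕ, k ≤ l → ∀ t ∈ Icc (0 : ℝ) (k + 1), V l t = V k t := by
    intro k l hkl t ht
    obtain ⟨C, H, hCH⟩ := hA (k + 1) (by positivity)
    have hkl' : (k : ℝ) ≤ l := by exact_mod_cast hkl
    exact interaction_unique hCH ((hV l).restrict le_rfl (by linarith)) (hV k)
      (by rw [hV0, hV0]) t ht
  -- The solution of index `k` lives on `[0, k+1]`, so index `⌈t⌉₊` always covers the time `t`;
  -- uniqueness makes the choices agree.
  refine ⟨fun t => V ⌈t⌉₊ t, by simp [hV0], fun T hT => ?_⟩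
  have hTk : T ≤ (⌈T⌉₊ : ℝ) + 1 := (Nat.le_ceil T).trans (by linarith)
  have hVT : ∀ t ∈ Icc 0 T, V ⌈t⌉₊ t = V ⌈T⌉₊ t := fun t ht =>
    (hagree _ _ (Nat.ceil_mono ht.2) t ⟨ht.1, (Nat.le_ceil t).trans (by linarith)⟩).symm
  exact ⟨((hV ⌈T⌉₊).restrict le_rfl hTk).congr hVT,
    ((hVc ⌈T⌉₊).mono (Icc_subset_Icc_right hTk)).congr hVT⟩

end

section

/-! ### Fourier coefficients of `L²` functions on the circle -/

theorem L2Circle.ext_fourierCoeff {f g : L2Circle}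
    (h : ∀ n : ℤ, fourierCoeff f n = fourierCoeff g n) : f = g := by
  apply fourierBasis.repr.injective
  ext n
  rw [fourierBasis_repr, fourierBasis_repr, h]

theorem fourierCoeff_sub_L2 (f g : L2Circle) (n : ℤ) :
    fourierCoeff (f - g : L2Circle) n = fourierCoeff f n - fourierCoeff g n := by
  simp only [← fourierBasis_repr, map_sub, lp.coeFn_sub, Pi.sub_apply]

theorem exists_L2Circle_of_sobolevBound {M : ℝ} {c : ℤ → ℂ} (hc : SobolevBound 0 M c) :
    ∃ f : L2Circle, ∀ n : ℤ, fourierCoeff f n = c n := by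
  have hm : Memℓp c 2 := by
    rw [memℓp_gen_iff (by norm_num)]
    simpa using hc.summable_sq le_rfl
  refine ⟨fourierBasis.repr.symm ⟨c, hm⟩, fun n => ?_⟩
  rw [← fourierBasis_repr, LinearIsometryEquiv.apply_symm_apply]

theorem exists_conj_mul_fourier (f : L2Circle) (n : ℤ) :
    ∃ g : L2Circle, (g =ᵐ[AddCircle.haarAddCircle]
        fun x => (starRingEnd ℂ) (f x) * fourier n x) ∧
      ∀ i : ℤ, fourierCoeff g i = (starRingEnd ℂ) (fourierCoeff f (n - i)) := by
  have hf := Lp.memLp f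
  have hm : MemLp (fun x : Circle2Pi => (starRingEnd ℂ) (f x) * fourier n x) 2
      AddCircle.haarAddCircle := by
    refine hf.of_le ((Complex.continuous_conj.comp_aestronglyMeasurable hf.1).mul
      (fourier n).continuous.aestronglyMeasurable) (Eventually.of_forall fun x => ?_)
    rw [norm_mul, Complex.norm_conj, fourier_apply, Circle.norm_coe, mul_one]
  refine ⟨hm.toLp _, hm.coeFn_toLp, fun i => ?_⟩
  rw [fourierCoeff_congr_ae hm.coeFn_toLp]
  unfold fourierCoeff
  rw [← integral_conj]
  refine integral_congr_ae (Eventually.of_forall fun x => ?_)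
  simp only [smul_eq_mul, map_mul]
  rw [← fourier_neg, neg_neg, sub_eq_add_neg, fourier_add]
  ring

/-- The square is only integrable, so its coefficient is read as the `L²` inner product of `f` with
`conj f · e_n`, and Parseval gives the convolution. -/
theorem fourierCoeff_sq (f : L2Circle) (n : ℤ) :
    fourierCoeff (fun x : Circle2Pi => (f x) ^ 2) n =
      ∑' m : ℤ, fourierCoeff f m * fourierCoeff f (n - m) := by
  obtain ⟨g, hg, hgc⟩ := exists_conj_mul_fourier f n
  have h := (fourierBasis.hasSum_inner_mul_inner g f).tsum_eq
  have e1 : ∀ i : ℤ, inner ℂ g (fourierBasis i) * inner ℂ (fourierBasis i) f =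
      fourierCoeff f i * fourierCoeff f (n - i) := by
    intro i
    rw [← inner_conj_symm, ← fourierBasis.repr_apply_apply, ← fourierBasis.repr_apply_apply,
      fourierBasis_repr, fourierBasis_repr, hgc, Complex.conj_conj, mul_comm]
  simp only [e1] at h
  rw [h, L2.inner_def]
  refine integral_congr_ae ?_
  filter_upwards [hg] with x hx
  rw [hx, RCLike.inner_apply, map_mul, Complex.conj_conj, ← fourier_neg, smul_eq_mul]
  ring

theorem realValued_iff (f : L2Circle) : RealValued f ↔ IsConjSymm (fun n => fourierCoeff f n) := by
  obtain ⟨g, hg, hgc⟩ := exists_conj_mul_fourier f 0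
  constructor
  · intro hf n
    have hgf : g = f := by
      refine Lp.ext ?_
      filter_upwards [hg, hf] with x hx hfx
      rw [hx, fourier_zero, mul_one]
      exact Complex.conj_eq_iff_im.2 hfx
    have := hgc (-n)
    rw [hgf] at this
    simpa using this
  · intro hf
    have hgf : g = f := by
      refine L2Circle.ext_fourierCoeff fun n => ?_
      have := hf (-n)
      rw [neg_neg] at this
      rw [hgc, zero_sub]
      exact this.symm
    rw [hgf] at hg
    unfold RealValued
    filter_upwards [hg] with x hx
    rw [fourier_zero, mul_one] at hx
    exact Complex.conj_eq_iff_im.1 hx.symm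

/-! ### Sobolev norms and coefficient bounds -/

theorem bracket_rpow_two_mul (n : ℤ) (s x : ℝ) :
    bracket n ^ (2 * s) * x ^ 2 = (bracket n ^ s * x) ^ 2 := by
  rw [mul_pow, ← Real.rpow_natCast (bracket n ^ s), ← Real.rpow_mul (bracket_pos _).le, mul_comm s]
  norm_num

variable {s : ℝ}

theorem SobolevBound.memSobolev {M : ℝ} {f : L2Circle}
    (h : SobolevBound s M (fun n => fourierCoeff f n)) : MemSobolev s f := by
  unfold MemSobolev
  simp only [bracket_rpow_two_mul]
  exact h.summable

theorem SobolevBound.sobolevNorm_le {M : ℝ} {f : L2Circle}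
    (h : SobolevBound s M (fun n => fourierCoeff f n)) : sobolevNorm s f ≤ M := by
  unfold sobolevNorm
  simp only [bracket_rpow_two_mul]
  rw [Real.sqrt_le_left h.1]
  exact Real.tsum_le_of_sum_le (fun _ => sq_nonneg _) h.2

theorem MemSobolev.sobolevBound {f : L2Circle} (h : MemSobolev s f) :
    SobolevBound s (sobolevNorm s f) (fun n => fourierCoeff f n) := by
  refine ⟨Real.sqrt_nonneg _, fun S => ?_⟩
  unfold MemSobolev at h
  unfold sobolevNorm
  simp only [bracket_rpow_two_mul] at h ⊢
  rw [Real.sq_sqrt (tsum_nonneg fun _ => sq_nonneg _)]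
  exact h.sum_le_tsum S fun _ _ => sq_nonneg _

theorem continuousInSobolev_iff {J : Set ℝ} {u : ℝ → L2Circle} :
    ContinuousInSobolev s J u ↔ SobolevContinuousOn s J (fun t n => fourierCoeff (u t) n) := by
  constructor
  · rintro ⟨h1, h2⟩
    refine ⟨fun t ht => ⟨_, (h1 t ht).sobolevBound⟩, fun t ht ε hε => ?_⟩
    filter_upwards [(h2 t ht).eventually (gt_mem_nhds hε), self_mem_nhdsWithin] with r hr hrJ
    have h3 : SobolevBound s _ (fun n => fourierCoeff (u r - u t : L2Circle) n) :=
      ((h1 r hrJ).sobolevBound.sub (h1 t ht).sobolevBound).of_norm_le fun n => by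
        rw [fourierCoeff_sub_L2]
    exact (h3.memSobolev.sobolevBound.mono hr.le).of_norm_le fun n => by
      rw [fourierCoeff_sub_L2]
  · rintro ⟨h1, h2⟩
    refine ⟨fun t ht => (h1 t ht).choose_spec.memSobolev, fun t ht => ?_⟩
    rw [Metric.tendsto_nhds]
    intro ε hε
    filter_upwards [h2 t ht (ε / 2) (by positivity)] with r hr
    have h3 : SobolevBound s (ε / 2) (fun n => fourierCoeff (u r - u t : L2Circle) n) :=
      hr.of_norm_le fun n => by rw [fourierCoeff_sub_L2]
    rw [Real.dist_eq, sub_zero, abs_of_nonneg (show 0 ≤ sobolevNorm s (u r - u t) from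
      Real.sqrt_nonneg _)]
    linarith [h3.sobolevNorm_le]

/-! ### Strong continuity of the modulated linear propagator -/

theorem phase_neg_mul_phase (θ : ℝ) (k : ℤ) : phase (-θ) k * phase θ k = 1 := by
  unfold phase
  rw [← Complex.exp_add]
  simp

theorem flowSymbol_eq_phase (θ : ℝ) (n : ℤ) : flowSymbol θ n = phase θ (|n| * n) := by
  unfold flowSymbol phase
  rw [boSymbol_eq]
  congr 1
  rw [Complex.ofReal_intCast]
  ring

/-- The phases are not equicontinuous in the frequency, so continuity is only strong: finitely many
modes move continuously and the remaining tail of `g t` is small in norm. -/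
theorem SobolevContinuousOn.phase_mul {J : Set ℝ} {g : ℝ → ℤ → ℂ} {w : ℝ → ℝ}
    (hg : SobolevContinuousOn s J g) (hw : ContinuousOn w J) (κ : ℤ → ℤ) :
    SobolevContinuousOn s J (fun t n => phase (w t) (κ n) * g t n) := by
  refine ⟨fun t ht => (hg.1 t ht).imp fun M hM => hM.of_norm_le fun n => by
    rw [norm_mul, norm_phase, one_mul], fun t ht ε hε => ?_⟩
  obtain ⟨M, hM⟩ := hg.1 t ht
  obtain ⟨S, hS⟩ := hM.exists_finset_tail (show 0 < ε / 4 by positivity)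
  have hlow : Tendsto (fun r => ∑ n ∈ S, (bracket n ^ s *
      ‖(phase (w r) (κ n) - phase (w t) (κ n)) * g t n‖) ^ 2) (𝓝[J] t) (𝓝 0) := by
    have hterm : ∀ n ∈ S, Tendsto (fun r => (bracket n ^ s *
        ‖(phase (w r) (κ n) - phase (w t) (κ n)) * g t n‖) ^ 2) (𝓝[J] t) (𝓝 0) := by
      intro n _
      have h1 := ((continuous_phase (κ n)).tendsto (w t)).comp (hw t ht)
      have h2 := ((((h1.sub_const (phase (w t) (κ n))).mul_const (g t n)).norm).const_mul
        (bracket n ^ s)).pow 2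
      simpa using h2
    simpa using tendsto_finsetSum S hterm
  filter_upwards [hg.2 t ht (ε / 4) (by positivity),
    hlow.eventually (gt_mem_nhds (show 0 < (ε / 4) ^ 2 by positivity))] with r hr hlr
  have b1 : SobolevBound s (ε / 4) (fun n => phase (w r) (κ n) * (g r n - g t n)) :=
    hr.of_norm_le fun n => by rw [norm_mul, norm_phase, one_mul]
  -- On the tail the phases at the two times are not compared; each contributes `ε / 4`.
  have b2 : SobolevBound s (ε / 4 + ε / 4) (fun n =>
      phase (w r) (κ n) * (if n ∈ S then 0 else g t n) -
      phase (w t) (κ n) * (if n ∈ S then 0 else g t n)) :=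
    SobolevBound.sub (hS.of_norm_le fun n => by rw [norm_mul, norm_phase, one_mul])
      (hS.of_norm_le fun n => by rw [norm_mul, norm_phase, one_mul])
  have b3 : SobolevBound s (ε / 4) (fun n => if n ∈ S then
      (phase (w r) (κ n) - phase (w t) (κ n)) * g t n else 0) := by
    refine ⟨by positivity, fun S' => ?_⟩
    calc _ ≤ ∑ n ∈ S' ∪ S, (bracket n ^ s * ‖if n ∈ S then
          (phase (w r) (κ n) - phase (w t) (κ n)) * g t n else 0‖) ^ 2 :=
          Finset.sum_le_sum_of_subset_of_nonneg Finset.subset_union_left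
            fun _ _ _ => sq_nonneg _
      _ = ∑ n ∈ S, (bracket n ^ s * ‖if n ∈ S then
          (phase (w r) (κ n) - phase (w t) (κ n)) * g t n else 0‖) ^ 2 :=
          (Finset.sum_subset Finset.subset_union_right fun n _ hn => by simp [hn]).symm
      _ = ∑ n ∈ S, (bracket n ^ s *
          ‖(phase (w r) (κ n) - phase (w t) (κ n)) * g t n‖) ^ 2 :=
          Finset.sum_congr rfl fun n hn => by simp [hn]
      _ ≤ _ := hlr.le
  refine (((b1.add b2).add b3).mono (by linarith)).of_norm_le fun n => le_of_eq ?_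
  congr 1
  split_ifs <;> ring

/-! ### Solutions and their interaction representation -/

/-- The interaction representation `U^w(t)⁻¹ u(t)` of `u`, through its Fourier coefficients. -/
noncomputable def interaction (w : ℝ → ℝ) (u : ℝ → L2Circle) (t : ℝ) (n : ℤ) : ℂ :=
  phase (-(w t)) (|n| * n) * fourierCoeff (u t) n

theorem fourierCoeff_eq_phase_mul_interaction (w : ℝ → ℝ) (u : ℝ → L2Circle) (t : ℝ) (n : ℤ) :
    fourierCoeff (u t) n = phase (w t) (|n| * n) * interaction w u t n := by
  rw [interaction, ← mul_assoc, mul_comm (phase (w t) _), phase_neg_mul_phase, one_mul]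

/-- The outer inverse propagator and those of the two factors of the square combine into the single
phase with frequency `Ω(n,m)`. -/
theorem duhamel_integrand_eq (w : ℝ → ℝ) (u : ℝ → L2Circle) (t : ℝ) (n : ℤ) :
    (flowSymbol (w t) n)⁻¹ *
      (derivSymbol n * fourierCoeff (fun x : Circle2Pi => (u t x) ^ 2) n) =
      nonlin (w t) (interaction w u t) (interaction w u t) n := by
  have hinv : (flowSymbol (w t) n)⁻¹ = phase (-(w t)) (|n| * n) := by
    rw [flowSymbol_eq_phase]
    exact (eq_inv_of_mul_eq_one_left (phase_neg_mul_phase _ _)).symm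
  have hneg : ∀ k, phase (-(w t)) k = phase (w t) (-k) := fun k => by
    unfold phase; congr 1; push_cast; ring
  rw [hinv, fourierCoeff_sq, nonlin, derivSymbol, mul_left_comm, ← tsum_mul_left]
  congr 1
  refine tsum_congr fun m => ?_
  rw [fourierCoeff_eq_phase_mul_interaction w u t m,
    fourierCoeff_eq_phase_mul_interaction w u t (n - m), hneg]
  have e : resonance n m = -(|n| * n) + |m| * m + |n - m| * (n - m) := by
    unfold resonance; ring
  rw [e, phase_add, phase_add]
  ring

variable {w : ℝ → ℝ} {J : Set ℝ} {u₀ : L2Circle} {u : ℝ → L2Circle}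

theorem interaction_zero (hw0 : w 0 = 0) (n : ℤ) :
    interaction w u 0 n = fourierCoeff (u 0) n := by
  simp [interaction, hw0, phase]

theorem IsSolution.isInteractionSolution (hu : IsSolution w s J u₀ u) (hs : 0 ≤ s)
    (hw0 : w 0 = 0) {T : ℝ} (hJ : Icc 0 T ⊆ J) (hw : ContinuousOn w (Icc 0 T))
    (hmean : MeanZero u₀) :
    IsInteractionSolution w 0 T (interaction w u) ∧
      SobolevContinuousOn s (Icc 0 T) (interaction w u) := by
  have hc := (continuousInSobolev_iff.1 hu.continuous).mono hJ
  have hv : SobolevContinuousOn s (Icc 0 T) (interaction w u) :=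
    hc.phase_mul (w := fun t => -(w t)) hw.neg fun n => |n| * n
  have hv0 := hv.of_le_order hs
  refine ⟨⟨fun t ht => ?_, hv0, fun n => hv0.continuousOn_nonlin hv0 hw n, fun t ht n => ?_⟩, hv⟩
  -- The mean is conserved because the nonlinearity is an exact derivative.
  · have h1 : fourierCoeff u₀ 0 = 0 := hmean
    have h2 := hu.duhamel t (hJ ht) 0
    rw [h1] at h2
    simp only [derivSymbol, Int.cast_zero, mul_zero, zero_mul, intervalIntegral.integral_zero,
      add_zero] at h2
    rw [interaction, h2, mul_zero]
  · rw [interaction_zero hw0, hu.initial, interaction, hu.duhamel t (hJ ht) n, flowSymbol_eq_phase,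
      mul_add, ← mul_assoc, ← mul_assoc, phase_neg_mul_phase, one_mul, one_mul]
    simp only [duhamel_integrand_eq]

theorem exists_isSolution (hs : 0 ≤ s) (hw0 : w 0 = 0) (hJ0 : 0 ∈ J)
    (hJ : ∀ t ∈ J, 0 ≤ t ∧ Icc 0 t ⊆ J) (hw : ContinuousOn w J) {v : ℝ → ℤ → ℂ}
    (hv0 : ∀ n, v 0 n = fourierCoeff u₀ n) (hvc : SobolevContinuousOn s J v)
    (hv : ∀ t ∈ J, IsInteractionSolution w 0 t v) :
    ∃ u : ℝ → L2Circle, IsSolution w s J u₀ u ∧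
      ∀ t ∈ J, ∀ n, fourierCoeff (u t) n = phase (w t) (|n| * n) * v t n := by
  have hex : ∀ t ∈ J, ∃ f : L2Circle, ∀ n : ℤ, fourierCoeff f n =
      phase (w t) (|n| * n) * v t n := by
    intro t ht
    obtain ⟨M, hM⟩ := hvc.1 t ht
    exact exists_L2Circle_of_sobolevBound (M := M) ((hM.of_le_order hs).of_norm_le fun n => by
      rw [norm_mul, norm_phase, one_mul])
  choose! u hu using hex
  have hint : ∀ t ∈ J, interaction w u t = v t := fun t ht => by
    funext n
    rw [interaction, hu t ht, ← mul_assoc, phase_neg_mul_phase, one_mul]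
  refine ⟨u, ⟨?_, ?_, fun t ht n => ?_⟩, hu⟩
  · rw [continuousInSobolev_iff]
    exact (hvc.phase_mul hw fun n => |n| * n).congr fun t ht => funext (hu t ht)
  · refine L2Circle.ext_fourierCoeff fun n => ?_
    rw [hu 0 hJ0, hv0, hw0]
    simp [phase]
  · obtain ⟨h0, hsub⟩ := hJ t ht
    rw [hu t ht, IsPath.eq (hv t ht) t (right_mem_Icc.2 h0) n, hv0, flowSymbol_eq_phase, mul_add]
    congr 2
    refine intervalIntegral.integral_congr fun τ hτ => ?_
    rw [uIcc_of_le h0] at hτ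
    simp only [duhamel_integrand_eq, hint τ (hsub hτ)]

theorem isUniqueSolution_of_admissible {ρ γ : ℝ} (hu : IsSolution w s J u₀ u) (hs : 0 ≤ s)
    (hw0 : w 0 = 0) (hmean : MeanZero u₀)
    (hJ : ∀ t ∈ J, 0 ≤ t ∧ Icc 0 t ⊆ J)
    (hA : ∀ t ∈ J, ∃ C H, IsAdmissible ρ γ C H 0 t w) : IsUniqueSolution w s J u₀ u := by
  refine ⟨hu, fun v hv t ht => L2Circle.ext_fourierCoeff fun n => ?_⟩
  obtain ⟨C, H, hCH⟩ := hA t ht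
  obtain ⟨h0, hsub⟩ := hJ t ht
  have h1 := (hu.isInteractionSolution hs hw0 hsub hCH.cont hmean).1
  have h2 := (hv.isInteractionSolution hs hw0 hsub hCH.cont hmean).1
  have h3 := interaction_unique hCH h2 h1 (funext fun n => by
    rw [interaction_zero hw0, interaction_zero hw0, hu.initial, hv.initial]) t (right_mem_Icc.2 h0)
  rw [fourierCoeff_eq_phase_mul_interaction w v, h3, ← fourierCoeff_eq_phase_mul_interaction]

theorem realValued_of_interaction {ρ γ C H T : ℝ} (hA : IsAdmissible ρ γ C H 0 T w)
    {v : ℝ → ℤ → ℂ} (hv : IsInteractionSolution w 0 T v)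
    (hv0 : ∀ n, v 0 n = fourierCoeff u₀ n) (hreal : RealValued u₀) {t : ℝ} (ht : t ∈ Icc 0 T)
    {f : L2Circle} (hf : ∀ n, fourierCoeff f n = phase (w t) (|n| * n) * v t n) :
    RealValued f := by
  rw [realValued_iff] at hreal ⊢
  have h1 := hv.isConjSymm hA (fun n => by rw [hv0, hv0]; exact hreal n) t ht
  intro n
  change fourierCoeff f (-n) = (starRingEnd ℂ) (fourierCoeff f n)
  rw [hf, hf, h1 n, map_mul, conj_phase, abs_neg, mul_neg]

/-! ### Irregular modulations -/

theorem IsIrregularOn.exists_isAdmissible {ρ γ T : ℝ} (hw : IsIrregularOn ρ γ T w)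
    (hρ : 5 / 2 < ρ) (hγ : 0 < γ) : ∃ C H, IsAdmissible ρ γ C H 0 T w := by
  obtain ⟨hcont, C, hC⟩ := hw
  obtain ⟨H, hH⟩ := exists_resonanceKernel_bound (σ := 0) (ρ := ρ) le_rfl (by linarith)
  refine ⟨max C 0, H, hγ, le_max_right _ _, hcont, fun r t hr hrt ht k => ?_, hH⟩
  -- The irregularity bound concerns `r < t` only; on the degenerate interval the integral vanishes.
  rcases hrt.eq_or_lt with rfl | hlt
  · rw [intervalIntegral.integral_same, norm_zero]
    have := bracket_rpow_pos k (-ρ)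
    have : 0 ≤ (r - r) ^ γ := by rw [sub_self]; exact Real.rpow_nonneg le_rfl γ
    have : 0 ≤ max C 0 := le_max_right _ _
    positivity
  · have h := hC k r t hr hlt ht
    have hb := bracket_rpow_pos k ρ
    have hpos : 0 < (t - r) ^ γ := Real.rpow_pos_of_pos (by linarith) γ
    rw [abs_of_pos (by linarith : 0 < t - r), ← mul_div_assoc, div_le_iff₀ hpos] at h
    rw [Real.rpow_neg (bracket_pos _).le, ← div_eq_mul_inv, le_div_iff₀ hb, mul_comm]
    exact h.trans (mul_le_mul_of_nonneg_right (le_max_left _ _) hpos.le)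

/-! ### Well-posedness and smoothing -/

theorem unconditionallyLocallyWellPosed {ρ γ T : ℝ} (hρ : 5 / 2 < ρ) (hγ : 0 < γ) (hT : 0 < T)
    (hw0 : w 0 = 0) (hw : IsIrregularOn ρ γ T w) (hs : 0 ≤ s) :
    UnconditionallyLocallyWellPosed w T s := by
  intro u₀ hu₀ hmean
  obtain ⟨C, H, hA⟩ := hw.exists_isAdmissible hρ hγ
  have hRs := hu₀.sobolevBound
  have hR := hRs.of_le_order hs
  obtain ⟨h, hh, hhT, hsmall⟩ :=
    exists_small_duhamelConst hγ C H s (16 * sobolevNorm s u₀) hT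
  have hA' := hA.restrict le_rfl hhT
  obtain ⟨v, hv0, hv, -, hvs⟩ := exists_interaction_solution hh.le hA' hs hh (by simp) hmean hR hRs
    hsmall
  have hJ : ∀ t ∈ Icc 0 h, 0 ≤ t ∧ Icc 0 t ⊆ Icc 0 h :=
    fun t ht => ⟨ht.1, Icc_subset_Icc_right ht.2⟩
  obtain ⟨u, hu, huv⟩ := exists_isSolution (u₀ := u₀) hs hw0 (left_mem_Icc.2 hh.le) hJ hA'.cont
    (congrFun hv0) (interaction_sobolevContinuousOn hA' hs hv hvs)
    fun t ht => hv.restrict le_rfl ht.2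
  exact ⟨h, hh, hhT, u, isUniqueSolution_of_admissible hu hs hw0 hmean hJ
    fun t ht => ⟨C, H, hA'.restrict le_rfl ht.2⟩,
    fun hreal t ht => realValued_of_interaction hA' hv (congrFun hv0) hreal ht (huv t ht)⟩

theorem unconditionallyGloballyWellPosed {ρ γ : ℝ} (hρ : 5 / 2 < ρ) (hγ : 0 < γ)
    (hw0 : w 0 = 0) (hw : IsIrregularOnHalfLine ρ γ w) (hs : 0 ≤ s) :
    UnconditionallyGloballyWellPosed w s := by
  intro u₀ hu₀ hmean hreal
  have hA : ∀ T : ℝ, 0 < T → ∃ C H, IsAdmissible ρ γ C H 0 T w :=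
    fun T hT => (hw T hT).exists_isAdmissible hρ hγ
  have hA1 : ∀ t ∈ Ici (0 : ℝ), ∃ C H, IsAdmissible ρ γ C H 0 (t + 1) w :=
    fun t (ht : 0 ≤ t) => hA (t + 1) (by linarith)
  obtain ⟨v, hv0, hv⟩ := exists_global_interaction_solution hs hA hmean
    ((realValued_iff u₀).1 hreal) hu₀.sobolevBound
  have hJ : ∀ t ∈ Ici (0 : ℝ), 0 ≤ t ∧ Icc 0 t ⊆ Ici 0 := fun t ht => ⟨ht, Icc_subset_Ici_self⟩
  -- Ending the bounded interval at `t + 1` rather than `t` keeps times to the right of `t`, so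
  -- continuity on `[0,∞)` can be checked there.
  have hnhds : ∀ t ∈ Ici (0 : ℝ), 𝓝[Ici 0] t = 𝓝[Icc 0 (t + 1)] t := by
    intro t _
    rw [← Ici_inter_Iic]
    exact (nhdsWithin_inter_of_mem' (mem_nhdsWithin_of_mem_nhds
      (Iic_mem_nhds (by linarith)))).symm
  have hmem : ∀ t ∈ Ici (0 : ℝ), t ∈ Icc 0 (t + 1) := fun t ht => ⟨ht, by linarith⟩
  have hcont : ContinuousOn w (Ici 0) := by
    intro t ht
    obtain ⟨C, H, hCH⟩ := hA1 t ht
    rw [ContinuousWithinAt, hnhds t ht]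
    exact hCH.cont t (hmem t ht)
  have hv1 : ∀ t ∈ Ici (0 : ℝ), IsInteractionSolution w 0 (t + 1) v ∧
      SobolevContinuousOn s (Icc 0 (t + 1)) v :=
    fun t (ht : 0 ≤ t) => hv (t + 1) (by linarith)
  have hvc : SobolevContinuousOn s (Ici 0) v := by
    refine ⟨fun t ht => (hv1 t ht).2.1 t (hmem t ht), fun t ht ε hε => ?_⟩
    rw [hnhds t ht]
    exact (hv1 t ht).2.2 t (hmem t ht) ε hε
  obtain ⟨u, hu, huv⟩ := exists_isSolution (u₀ := u₀) hs hw0 self_mem_Ici hJ hcont (congrFun hv0)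
    hvc fun t ht => (hv1 t ht).1.restrict le_rfl (by linarith)
  refine ⟨u, isUniqueSolution_of_admissible (ρ := ρ) (γ := γ) hu hs hw0 hmean hJ fun t ht => ?_,
    fun t ht => ?_⟩
  · obtain ⟨C, H, hCH⟩ := hA1 t ht
    exact ⟨C, H, hCH.restrict le_rfl (by linarith)⟩
  · obtain ⟨C, H, hCH⟩ := hA1 t ht
    exact realValued_of_interaction hCH (hv1 t ht).1 (congrFun hv0) hreal (hmem t ht) (huv t ht)

theorem nonlinear_smoothing {ρ γ T τ s₀ : ℝ} (hρ : 5 / 2 < ρ) (hγ : 0 < γ) (hw0 : w 0 = 0)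
    (hw : IsIrregularOn ρ γ T w) (hs : 0 ≤ s) (hss₀ : s < s₀) (hs₀ : s₀ < s + ρ - 5 / 2)
    (hmean : MeanZero u₀) (hτT : τ ≤ T) (hu : IsSolution w s (Icc 0 τ) u₀ u) :
    ContinuousInSobolev s₀ (Icc 0 τ) (fun t => u t - linearFlow (w t) u₀) := by
  obtain ⟨C, H, hA⟩ := hw.exists_isAdmissible hρ hγ
  have hA' := hA.restrict le_rfl hτT
  obtain ⟨hv, hvc⟩ := hu.isInteractionSolution hs hw0 Subset.rfl hA'.cont hmean
  obtain ⟨A, -, hvA⟩ := hvc.exists_bound isCompact_Icc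
  -- The gain is `σ = s₀ - s`, and `s₀ < s + ρ - 5/2` is its Hilbert–Schmidt condition.
  obtain ⟨H', hH'⟩ := exists_resonanceKernel_bound (σ := s₀ - s) (ρ := ρ) (by linarith)
    (by linarith)
  have h1 := duhamel_sobolevContinuousOn hA' hH' hs hv hvA
  rw [add_sub_cancel] at h1
  rw [continuousInSobolev_iff]
  refine (h1.phase_mul hA'.cont fun n => |n| * n).congr fun t ht => funext fun n => ?_
  rw [fourierCoeff_sub_L2, fourierCoeff_linearFlow, flowSymbol_eq_phase, interaction_zero hw0,
    hu.initial, mul_sub, ← fourierCoeff_eq_phase_mul_interaction]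

end

end ModulatedBO

theorem theorem1p4 (ρ γ T : ℝ) (hρ : 5 / 2 < ρ) (hγ : 1 / 2 < γ) (hγ' : γ < 1) (hT : 0 < T)
    (w : ℝ → ℝ) (hw0 : w 0 = 0) (hw : ModulatedBO.IsIrregularOn ρ γ T w) :
    (∀ s : ℝ, 0 ≤ s →
      ModulatedBO.UnconditionallyLocallyWellPosed w T s ∧
        (ModulatedBO.IsIrregularOnHalfLine ρ γ w →
          ModulatedBO.UnconditionallyGloballyWellPosed w s)) ∧
    (∀ s s₀ : ℝ, 0 ≤ s → s < s₀ → s₀ ≤ ρ - 1 → s₀ < s + ρ - 5 / 2 →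
      ∀ u₀ : ModulatedBO.L2Circle, ModulatedBO.MemSobolev s u₀ → ModulatedBO.MeanZero u₀ →
        ∀ τ : ℝ, 0 < τ → τ ≤ T →
          ∀ u : ℝ → ModulatedBO.L2Circle,
            ModulatedBO.IsSolution w s (Set.Icc 0 τ) u₀ u →
              ModulatedBO.ContinuousInSobolev s₀ (Set.Icc 0 τ)
                (fun t => u t - ModulatedBO.linearFlow (w t) u₀)) := by
  exact ⟨fun s hs =>
      ⟨ModulatedBO.unconditionallyLocallyWellPosed hρ (by linarith) hT hw0 hw hs,
        fun hw' => ModulatedBO.unconditionallyGloballyWellPosed hρ (by linarith) hw0 hw' hs⟩,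
    fun s s₀ hs hss₀ _ hs₀ u₀ _ hmean τ _ hτT u hu =>
      ModulatedBO.nonlinear_smoothing hρ (by linarith) hw0 hw hs hss₀ hs₀ hmean hτT hu⟩
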